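/- Let $n\in\mathbb N$. An open set $\Omega\subseteq\mathbb R^n$ is called *thick* if there are $c,\epsilon_1>0$ such that $|B_\epsilon(x)\cap\Omega|>c\,|B_\epsilon(x)|$ for all $\epsilon\in(0,\epsilon_1)$ and all $x\in\Omega$, where $B_\epsilon(x)$ is the open Euclidean ball and $|\cdot|$ is Lebesgue measure. Let $h\in L^1(\mathbb R^n)$, $h:\mathbb R^n\to\mathbb R$, satisfy: $h(x)\ge 0$ for all $x$; $h(Ox)=h(x)$ for all $x$ and all orthogonal $O$; $\|h\|_{L^1(\mathbb R^n)}=1$; and $h(y)\le h(x)$ for all $x,y$ with $\|x\|\le\|y\|$. For $\epsilon>0$ put $h_\epsilon(x)=\epsilon^{-n}h(x/\epsilon)$, $d_\epsilon=h_\epsilon*1_\Omega$, $p_\epsilon(x,y)=h_\epsilon(y-x)/d_\epsilon(x)$, and $$P_\epsilon f(x)=\int_\Omega p_\epsilon(x,y)f(y)\,dy .$$ **Theorem.** Let $\Omega\subseteq\mathbb R^n$ be a thick open set and $h$ as above. Then there exists $\epsilon_0>0$ such that $d_\epsilon>0$ on $\Omega$ for all $\epsilon\in(0,\epsilon_0)$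 and, for every $p\in[1,\infty]$, $\{P_\epsilon\}_{0<\epsilon<\epsilon_0}$ is a well-defined, uniformly bounded family of linear operators from $L^p(\Omega)$ to itself: for every $f\in L^p(\Omega)$ the integral defining $P_\epsilon f(x)$ converges absolutely for a.e. $x\in\Omega$, and there is $A$, depending on $p$ but not on $\epsilon$ or $f$, with $\|P_\epsilon f\|_{L^p(\Omega)}\le A\|f\|_{L^p(\Omega)}$ for all $f\in L^p(\Omega)$ and $\epsilon\in(0,\epsilon_0)$. If, in addition, $|h(x)|\le C(1+\|x\|)^{-(n+\delta)}$ for all $x$ and some $C,\delta>0$, then the following hold. 1. For every $p\in(1,\infty]$ and $f\in L^p(\Omega)$, $P_\epsilon f(x)\to f(x)$ as $\epsilon\to0^+$ for a.e. $x\in\Omega$. 2. For every $p\in(1,\infty)$ and $f\in L^p(\Omega)$, $\|P_\epsilon f-f\|_{L^p(\Omega)}\to0$ as $\epsilon\to0^+$. 3. For every $p\in(1,\infty]$, with $q$ given by $\frac1p+\frac1q=1$, if $h\in L^q(\mathbb R^n)$, then for every $f\in L^p(\Omega)$ and $\epsilon\in(0,\epsilon_0)$ the integral defining $P_\epsilon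 f(x)$ converges absolutely for every $x\in\Omega$ and $P_\epsilon f$ is a bounded continuous function on $\Omega$. 4. If $\Omega$ is bounded, $r\in\mathbb N_0$, and $h\in H^r(\mathbb R^n)$, i.e. $h\in L^2(\mathbb R^n)$ and its Fourier transform $\hat h$ satisfies $\int_{\mathbb R^n}|\hat h(\omega)|^2(1+\|\omega\|^2)^r\,d\omega<\infty$, then for every $f\in L^2(\Omega)$ and $\epsilon\in(0,\epsilon_0)$ the integral defining $P_\epsilon f(x)$ converges absolutely for every $x\in\Omega$ and $P_\epsilon f$ is $r$ times continuously differentiable on $\Omega$. -/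

import Mathlib

open MeasureTheory Filter Topology Metric
open scoped ENNReal FourierTransform

/-- A Lebesgue-measurable set `Ω ⊆ ℝⁿ` is thick if there are `c, ε₀ > 0` such that
`|B_ε(x) ∩ Ω| > c |B_ε(x)|` for all `ε ∈ (0, ε₀)` and all `x ∈ Ω`. -/
def IsThick {n : ℕ} (Ω : Set (EuclideanSpace ℝ (Fin n))) : Prop :=
  NullMeasurableSet Ω volume ∧
    ∃ c : ℝ, 0 < c ∧ ∃ ε₀ : ℝ, 0 < ε₀ ∧ ∀ ε : ℝ, 0 < ε → ε < ε₀ → ∀ x ∈ Ω,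
      ENNReal.ofReal c * volume (ball x ε) < volume (ball x ε ∩ Ω)

/-- A shape function: integrable, nonnegative, invariant under orthogonal transformations, and of
`L¹` norm one. -/
structure IsShapeFunction {n : ℕ} (h : EuclideanSpace ℝ (Fin n) → ℝ) : Prop where
  integrable : Integrable h volume
  nonneg : ∀ x, 0 ≤ h x
  radial : ∀ (O : EuclideanSpace ℝ (Fin n) ≃ₗᵢ[ℝ] EuclideanSpace ℝ (Fin n))
    (x : EuclideanSpace ℝ (Fin n)), h (O x) = h x
  norm_eq_one : ∫ x, ‖h x‖ = 1

/-- `h` is radially decreasing: `h y ≤ h x` whenever `‖x‖ ≤ ‖y‖`. -/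
def IsRadiallyDecreasing {n : ℕ} (h : EuclideanSpace ℝ (Fin n) → ℝ) : Prop :=
  ∀ x y : EuclideanSpace ℝ (Fin n), ‖x‖ ≤ ‖y‖ → h y ≤ h x

/-- The rescaled shape function `h_ε(x) = ε⁻ⁿ h(x / ε)`. -/
noncomputable def scaledShape {n : ℕ} (h : EuclideanSpace ℝ (Fin n) → ℝ) (ε : ℝ)
    (x : EuclideanSpace ℝ (Fin n)) : ℝ :=
  (ε ^ n)⁻¹ * h (ε⁻¹ • x)

/-- The degree function `d_ε(x) = (h_ε * 1_Ω)(x) = ∫ h_ε(x - y) 1_Ω(y) dy`. -/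
noncomputable def degreeFn {n : ℕ} (h : EuclideanSpace ℝ (Fin n) → ℝ)
    (Ω : Set (EuclideanSpace ℝ (Fin n))) (ε : ℝ) (x : EuclideanSpace ℝ (Fin n)) : ℝ :=
  ∫ y, scaledShape h ε (x - y) * Ω.indicator (fun _ => (1 : ℝ)) y

/-- The Markov kernel `p_ε(x, y) = h_ε(y - x) / d_ε(x)`. -/
noncomputable def markovKernel {n : ℕ} (h : EuclideanSpace ℝ (Fin n) → ℝ)
    (Ω : Set (EuclideanSpace ℝ (Fin n))) (ε : ℝ) (x y : EuclideanSpace ℝ (Fin n)) : ℝ :=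
  scaledShape h ε (y - x) / degreeFn h Ω ε x

/-- The Markov-normalized smoothing `(P_ε f)(x) = ∫_Ω p_ε(x, y) f(y) dy`; only the values of `f`
on `Ω` matter. -/
noncomputable def markovSmooth {n : ℕ} (h : EuclideanSpace ℝ (Fin n) → ℝ)
    (Ω : Set (EuclideanSpace ℝ (Fin n))) (ε : ℝ) (f : EuclideanSpace ℝ (Fin n) → ℝ)
    (x : EuclideanSpace ℝ (Fin n)) : ℝ :=
  ∫ y in Ω, markovKernel h Ω ε x y * f y

/-- `h ∈ H^r(ℝⁿ)`: `h` is in `L²`, and its `L²` Fourier transform `ĥ` satisfies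
`∫ |ĥ(ω)|² (1 + ‖ω‖²)^r dω < ∞`. (Mathlib's Fourier transform has frequency `2π ω`, which changes
the norm to an equivalent one but does not change the space.) -/
def MemSobolevH {n : ℕ} (r : ℕ) (h : EuclideanSpace ℝ (Fin n) → ℝ) : Prop :=
  ∃ hL : MemLp (fun x => (h x : ℂ)) 2 volume,
    ∫⁻ ω, ‖(𝓕 (hL.toLp (fun x => (h x : ℂ))) : Lp ℂ 2 (volume : Measure
      (EuclideanSpace ℝ (Fin n)))) ω‖ₑ ^ 2 * ENNReal.ofReal ((1 + ‖ω‖ ^ 2) ^ r) < ∞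

/-! ### Affine substitution `y = x + ε • z` -/

section ChangeOfVariables

variable {n : ℕ} {F : Type*} [NormedAddCommGroup F]

/-! Substituting `y = x + ε • z` gives `P_ε f(x) = (∫ h(z) (1_Ω f)(x + ε z) dz) / d_ε(x)`. The
numerator averages translates of the zero extension of `f` against the probability measure `h dz`,
and `d_ε` is the same average of `1_Ω`. Thickness bounds `d_ε` below on `Ω` by a constant `d > 0`
uniformly in small `ε` (`exists_le_degreeFn`), so division costs at most a factor `d⁻¹`.

Boundedness on `L^p` is Jensen, Tonelli and translation invariance (`eLpNorm_markovSmooth_le`).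
Since `P_ε 1 = 1` on `Ω`, the error `P_ε f(x) - f(x)` is `P_ε` applied to `f - f(x)`, hence at most
`d⁻¹` times an average of `|f(x + ε z) - f(x)|` over `x + ε z ∈ Ω` (`enorm_markovSmooth_sub_le`).
Norm convergence then follows from continuity of translation in `L^p` and dominated convergence in
`z`. For pointwise convergence the decay of `h` gives a majorant by multiples of indicators of
dyadic balls, so the error is at most a sum of ball averages with geometric weights; at a Lebesgue
point each average tends to zero and all are bounded, so the sum tends to zero
(`tendsto_shapeAverage_zero`).

For regularity, numerator and degree are treated separately. Continuity comes from the Hölder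
pairing with a translate of `h_ε` that moves continuously in `L^q`. For `h ∈ H^r`, Plancherel writes
each as the Fourier transform of a function with integrable moments up to order `r`
(`contDiff_integral_translate_mul`). -/

theorem lintegral_comp_add_smul (x : EuclideanSpace ℝ (Fin n)) {ε : ℝ} (hε : 0 < ε)
    (G : EuclideanSpace ℝ (Fin n) → ℝ≥0∞) :
    ∫⁻ z, G (x + ε • z) = ENNReal.ofReal (ε ^ n)⁻¹ * ∫⁻ y, G y := by
  calc ∫⁻ z, G (x + ε • z)
      = ∫⁻ y, G (x + y) ∂Measure.map (fun z => ε • z) volume :=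
        (lintegral_map_equiv (fun y => G (x + y))
          (Homeomorph.smul (isUnit_iff_ne_zero.2 hε.ne').unit).toMeasurableEquiv).symm
    _ = _ := by
        rw [Measure.map_addHaar_smul volume hε.ne', lintegral_smul_measure,
          lintegral_add_left_eq_self G x, finrank_euclideanSpace_fin,
          abs_of_nonneg (by positivity), smul_eq_mul]

theorem integral_comp_add_smul [NormedSpace ℝ F] (x : EuclideanSpace ℝ (Fin n)) {ε : ℝ}
    (hε : 0 < ε) (G : EuclideanSpace ℝ (Fin n) → F) :
    ∫ z, G (x + ε • z) = (ε ^ n)⁻¹ • ∫ y, G y := by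
  rw [Measure.integral_comp_smul volume (fun y => G (x + y)) ε, integral_add_left_eq_self G x,
    finrank_euclideanSpace_fin, abs_of_nonneg (by positivity)]

theorem integrable_comp_add_smul_iff (x : EuclideanSpace ℝ (Fin n)) {ε : ℝ}
    (hε : 0 < ε) (G : EuclideanSpace ℝ (Fin n) → F) :
    Integrable (fun z => G (x + ε • z)) ↔ Integrable G := by
  rw [integrable_comp_smul_iff volume (fun y => G (x + y)) hε.ne']
  refine ⟨fun hG => ?_, fun hG => hG.comp_add_left x⟩
  simpa using hG.comp_add_left (-x)

theorem quasiMeasurePreserving_add_smul (x : EuclideanSpace ℝ (Fin n)) {ε : ℝ} (hε : 0 < ε) :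
    Measure.QuasiMeasurePreserving (fun z : EuclideanSpace ℝ (Fin n) => x + ε • z)
      volume volume :=
  (measurePreserving_add_left volume x).quasiMeasurePreserving.comp
    (Measure.quasiMeasurePreserving_smul volume hε.ne')

theorem scaledShape_sub_mul_eq (h φ : EuclideanSpace ℝ (Fin n) → ℝ) {ε : ℝ} (hε : 0 < ε)
    (x : EuclideanSpace ℝ (Fin n)) :
    (fun z => h z * φ (x + ε • z)) =
      fun z => (fun y => h (ε⁻¹ • (y - x)) * φ y) (x + ε • z) := by
  funext z
  simp [smul_smul, inv_mul_cancel₀ hε.ne']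

theorem integral_scaledShape_sub_mul (h φ : EuclideanSpace ℝ (Fin n) → ℝ) {ε : ℝ} (hε : 0 < ε)
    (x : EuclideanSpace ℝ (Fin n)) :
    ∫ y, scaledShape h ε (y - x) * φ y = ∫ z, h z * φ (x + ε • z) := by
  rw [scaledShape_sub_mul_eq h φ hε x, integral_comp_add_smul x hε (fun y => h (ε⁻¹ • (y - x)) * φ y), smul_eq_mul,
    ← integral_const_mul]
  simp only [scaledShape, mul_assoc]

theorem integrable_scaledShape_sub_mul_iff (h φ : EuclideanSpace ℝ (Fin n) → ℝ) {ε : ℝ}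
    (hε : 0 < ε) (x : EuclideanSpace ℝ (Fin n)) :
    Integrable (fun y => scaledShape h ε (y - x) * φ y) ↔
      Integrable (fun z => h z * φ (x + ε • z)) := by
  rw [scaledShape_sub_mul_eq h φ hε x, integrable_comp_add_smul_iff x hε (fun y => h (ε⁻¹ • (y - x)) * φ y)]
  simp only [scaledShape, mul_assoc]
  rw [integrable_const_mul_iff]
  exact IsUnit.mk0 _ (by positivity)

end ChangeOfVariables

/-! ### The shape function and the lower bound on the degree -/

section Shape

variable {n : ℕ} {h : EuclideanSpace ℝ (Fin n) → ℝ} {Ω : Set (EuclideanSpace ℝ (Fin n))}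

theorem IsRadiallyDecreasing.eq_of_norm_eq (hdec : IsRadiallyDecreasing h)
    {x y : EuclideanSpace ℝ (Fin n)} (hxy : ‖x‖ = ‖y‖) : h x = h y :=
  le_antisymm (hdec _ _ hxy.ge) (hdec _ _ hxy.le)

/-- `h` is an antitone function of the radius composed with the norm. Genuine measurability, beyond
the a.e. version contained in integrability, is used for the density `h` and for joint measurability
in `(x, z)`. -/
theorem IsRadiallyDecreasing.measurable (hdec : IsRadiallyDecreasing h) : Measurable h := by
  rcases subsingleton_or_nontrivial (EuclideanSpace ℝ (Fin n)) with _ | _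
  · exact Subsingleton.measurable
  obtain ⟨e, he⟩ := exists_norm_eq (EuclideanSpace ℝ (Fin n)) zero_le_one
  have hanti : Antitone fun r : ℝ => h (max r 0 • e) := by
    intro r s hrs
    apply hdec
    simp only [norm_smul, he, mul_one, Real.norm_eq_abs]
    rw [abs_of_nonneg (le_max_right _ _), abs_of_nonneg (le_max_right _ _)]
    exact max_le_max_right _ hrs
  have : h = (fun r : ℝ => h (max r 0 • e)) ∘ norm := by
    funext x
    apply hdec.eq_of_norm_eq
    simp [norm_smul, he]
  rw [this]
  exact hanti.measurable.comp measurable_norm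

theorem IsShapeFunction.integral_eq_one (hs : IsShapeFunction h) : ∫ x, h x = 1 := by
  rw [← hs.norm_eq_one]
  exact integral_congr_ae (.of_forall fun x => (Real.norm_of_nonneg (hs.nonneg x)).symm)

/-- The integral of `h` is positive and, in positive dimension, the origin is null, so `h` is
positive at some nonzero point; monotonicity spreads that value over the ball it bounds. Dimension
zero is separate because the origin then carries all the mass. -/
theorem exists_pos_le_shape (hs : IsShapeFunction h) (hdec : IsRadiallyDecreasing h) :
    ∃ R > 0, ∃ η > 0, ∀ y, ‖y‖ < R → η ≤ h y := by
  rcases subsingleton_or_nontrivial (EuclideanSpace ℝ (Fin n)) with _ | _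
  · refine ⟨1, one_pos, h 0, ?_, fun y _ => by rw [Subsingleton.elim y 0]⟩
    refine (hs.nonneg 0).lt_of_ne fun h0 => ?_
    have : h = 0 := by funext x; rw [Subsingleton.elim x 0, ← h0]; rfl
    simpa [this] using hs.norm_eq_one
  · obtain ⟨x, hx0, hx⟩ : ∃ x, x ≠ 0 ∧ 0 < h x := by
      by_contra! hcon
      have : ∫ x, h x = 0 := by
        apply integral_eq_zero_of_ae
        filter_upwards [compl_mem_ae_iff.2 (measure_singleton (μ := volume)
          (0 : EuclideanSpace ℝ (Fin n)))] with x hx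
        exact le_antisymm (hcon x hx) (hs.nonneg x)
      simp [hs.integral_eq_one] at this
    exact ⟨‖x‖, norm_pos_iff.2 hx0, h x, hx, fun y hy => hdec _ _ hy.le⟩

theorem scaledShape_sub_comm (hs : IsShapeFunction h) (ε : ℝ) (x y : EuclideanSpace ℝ (Fin n)) :
    scaledShape h ε (x - y) = scaledShape h ε (y - x) := by
  unfold scaledShape
  rw [← neg_sub y x, smul_neg]
  congr 1
  exact hs.radial (LinearIsometryEquiv.neg ℝ) _

theorem degreeFn_eq (hs : IsShapeFunction h) {ε : ℝ} (hε : 0 < ε)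
    (x : EuclideanSpace ℝ (Fin n)) :
    degreeFn h Ω ε x = ∫ z, h z * Ω.indicator (fun _ => (1 : ℝ)) (x + ε • z) := by
  rw [← integral_scaledShape_sub_mul _ _ hε x]
  exact integral_congr_ae (.of_forall fun y => by simp only [scaledShape_sub_comm hs ε x y])

theorem markovKernel_mul_indicator (f : EuclideanSpace ℝ (Fin n) → ℝ) (ε : ℝ)
    (x : EuclideanSpace ℝ (Fin n)) :
    Ω.indicator (fun y => markovKernel h Ω ε x y * f y) =
      fun y => (scaledShape h ε (y - x) * Ω.indicator f y) / degreeFn h Ω ε x := by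
  funext y
  by_cases hy : y ∈ Ω <;> simp [hy, markovKernel, div_mul_eq_mul_div]

theorem markovSmooth_eq (hΩ : MeasurableSet Ω) (f : EuclideanSpace ℝ (Fin n) → ℝ) {ε : ℝ}
    (hε : 0 < ε) (x : EuclideanSpace ℝ (Fin n)) :
    markovSmooth h Ω ε f x = (∫ z, h z * Ω.indicator f (x + ε • z)) / degreeFn h Ω ε x := by
  unfold markovSmooth
  rw [← integral_indicator hΩ, markovKernel_mul_indicator, integral_div,
    integral_scaledShape_sub_mul _ _ hε]

theorem integrableOn_markovKernel_mul (hΩ : MeasurableSet Ω) {f : EuclideanSpace ℝ (Fin n) → ℝ}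
    {ε : ℝ} (hε : 0 < ε) {x : EuclideanSpace ℝ (Fin n)}
    (hf : Integrable fun z => h z * Ω.indicator f (x + ε • z)) :
    IntegrableOn (fun y => markovKernel h Ω ε x y * f y) Ω := by
  rw [← integrable_indicator_iff hΩ, markovKernel_mul_indicator]
  exact ((integrable_scaledShape_sub_mul_iff _ _ hε x).2 hf).div_const _

theorem markovSmooth_congr_ae {f g : EuclideanSpace ℝ (Fin n) → ℝ}
    (hfg : f =ᵐ[volume.restrict Ω] g) (ε : ℝ) : markovSmooth h Ω ε f = markovSmooth h Ω ε g := by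
  funext x
  refine integral_congr_ae ?_
  filter_upwards [hfg] with y hy
  rw [hy]

theorem integrable_shape_mul_of_bound (hs : IsShapeFunction h) {φ : EuclideanSpace ℝ (Fin n) → ℝ}
    (hφ : AEStronglyMeasurable φ) {M : ℝ} (hM : ∀ x, |φ x| ≤ M) {ε : ℝ} (hε : 0 < ε)
    (x : EuclideanSpace ℝ (Fin n)) : Integrable fun z => h z * φ (x + ε • z) :=
  hs.integrable.mul_bdd (hφ.comp_quasiMeasurePreserving (quasiMeasurePreserving_add_smul x hε))
    (.of_forall fun _ => hM _)

/-- On `B(x, εR)` the kernel is at least `ε⁻ⁿ η`, and thickness says that `Ω` fills a fixed fraction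
of this ball; the powers of `ε` cancel. -/
theorem exists_le_degreeFn (hs : IsShapeFunction h) (hdec : IsRadiallyDecreasing h)
    (hΩ : MeasurableSet Ω) (hthick : IsThick Ω) :
    ∃ d > 0, ∃ ε₀ > 0, ∀ ε, 0 < ε → ε < ε₀ → ∀ x ∈ Ω, d ≤ degreeFn h Ω ε x := by
  obtain ⟨R, hR, η, hη, hle⟩ := exists_pos_le_shape hs hdec
  obtain ⟨-, c, hc, ε₁, hε₁, hvol⟩ := hthick
  have hV : 0 < volume.real (ball (0 : EuclideanSpace ℝ (Fin n)) 1) :=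
    ENNReal.toReal_pos (measure_ball_pos _ _ one_pos).ne' measure_ball_lt_top.ne
  -- The threshold `ε₁ / R` makes the radius `ε * R` admissible in the thickness condition.
  refine ⟨η * (c * (R ^ n * volume.real (ball (0 : EuclideanSpace ℝ (Fin n)) 1))), by positivity,
    ε₁ / R, by positivity, fun ε hε hεlt x hx => ?_⟩
  have hεR : 0 < ε * R := by positivity
  have h1 := hvol (ε * R) hεR ((lt_div_iff₀ hR).1 hεlt) x hx
  have hfin : volume (ball x (ε * R) ∩ Ω) ≠ ∞ :=
    ((measure_mono Set.inter_subset_left).trans_lt measure_ball_lt_top).ne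
  have h2 : c * ((ε * R) ^ n * volume.real (ball (0 : EuclideanSpace ℝ (Fin n)) 1)) ≤
      volume.real (ball x (ε * R) ∩ Ω) := by
    have := ENNReal.toReal_mono hfin h1.le
    rwa [Measure.addHaar_ball_of_pos volume x hεR, ENNReal.toReal_mul, ENNReal.toReal_mul,
      ENNReal.toReal_ofReal hc.le, ENNReal.toReal_ofReal (by positivity),
      finrank_euclideanSpace_fin] at this
  have hmeas : MeasurableSet (ball x (ε * R) ∩ Ω) := measurableSet_ball.inter hΩ
  have h3 : ∫ y, (ε ^ n)⁻¹ * η * (ball x (ε * R) ∩ Ω).indicator (fun _ => (1 : ℝ)) y ≤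
      degreeFn h Ω ε x := by
    unfold degreeFn
    apply integral_mono_of_nonneg
    · refine .of_forall fun y => ?_
      have : 0 ≤ (ball x (ε * R) ∩ Ω).indicator (fun _ => (1 : ℝ)) y :=
        Set.indicator_nonneg (fun _ _ => zero_le_one) y
      dsimp only [Pi.zero_apply]
      positivity
    · rw [show (fun y => scaledShape h ε (x - y) * Ω.indicator (fun _ => (1 : ℝ)) y) =
        fun y => scaledShape h ε (y - x) * Ω.indicator (fun _ => (1 : ℝ)) y from
        funext fun y => by rw [scaledShape_sub_comm hs]]
      refine (integrable_scaledShape_sub_mul_iff _ _ hε x).2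
        (integrable_shape_mul_of_bound hs (M := 1) ?_ (fun y => ?_) hε x)
      · exact (measurable_const.indicator hΩ).aestronglyMeasurable
      · by_cases hy : y ∈ Ω <;> simp [hy]
    · refine .of_forall fun y => ?_
      dsimp only
      by_cases hy : y ∈ ball x (ε * R) ∩ Ω
      · rw [Set.indicator_of_mem hy, Set.indicator_of_mem hy.2]
        have : η ≤ h (ε⁻¹ • (x - y)) := by
          apply hle
          rw [norm_smul, norm_inv, Real.norm_of_nonneg hε.le, ← dist_eq_norm, dist_comm,
            inv_mul_lt_iff₀ hε]
          exact hy.1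
        unfold scaledShape
        gcongr
      · rw [Set.indicator_of_notMem hy, mul_zero]
        refine mul_nonneg (mul_nonneg (by positivity) (hs.nonneg _)) ?_
        exact Set.indicator_nonneg (fun _ _ => zero_le_one) y
  refine le_trans ?_ h3
  rw [integral_const_mul, integral_indicator_const _ hmeas, smul_eq_mul, mul_one]
  calc _ = (ε ^ n)⁻¹ * η * (c * ((ε * R) ^ n *
        volume.real (ball (0 : EuclideanSpace ℝ (Fin n)) 1))) := by
        rw [mul_pow]; field_simp
    _ ≤ _ := by gcongr

end Shape

/-- The measure with density `h` with respect to Lebesgue measure. -/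
noncomputable def shapeMeasure {n : ℕ} (h : EuclideanSpace ℝ (Fin n) → ℝ) :
    Measure (EuclideanSpace ℝ (Fin n)) :=
  volume.withDensity fun z => ENNReal.ofReal (h z)

/-! ### Pointwise bounds by averages against `h dz` -/

section ShapeMeasure

variable {n : ℕ} {h : EuclideanSpace ℝ (Fin n) → ℝ} {Ω : Set (EuclideanSpace ℝ (Fin n))}

theorem IsShapeFunction.isProbabilityMeasure (hs : IsShapeFunction h) :
    IsProbabilityMeasure (shapeMeasure h) := by
  refine ⟨?_⟩
  rw [shapeMeasure, withDensity_apply _ MeasurableSet.univ, Measure.restrict_univ,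
    ← ofReal_integral_eq_lintegral_ofReal hs.integrable (.of_forall hs.nonneg),
    hs.integral_eq_one, ENNReal.ofReal_one]

theorem shapeMeasure_absolutelyContinuous (h : EuclideanSpace ℝ (Fin n) → ℝ) :
    shapeMeasure h ≪ volume :=
  withDensity_absolutelyContinuous _ _

theorem lintegral_shapeMeasure (hdec : IsRadiallyDecreasing h)
    (G : EuclideanSpace ℝ (Fin n) → ℝ≥0∞) :
    ∫⁻ z, G z ∂shapeMeasure h = ∫⁻ z, ENNReal.ofReal (h z) * G z :=
  lintegral_withDensity_eq_lintegral_mul_non_measurable _ hdec.measurable.ennreal_ofReal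
    (.of_forall fun _ => ENNReal.ofReal_lt_top) _

theorem lintegral_enorm_shape_mul (hs : IsShapeFunction h) (hdec : IsRadiallyDecreasing h)
    (φ : EuclideanSpace ℝ (Fin n) → ℝ) :
    ∫⁻ z, ‖h z * φ z‖ₑ = ∫⁻ z, ‖φ z‖ₑ ∂shapeMeasure h := by
  rw [lintegral_shapeMeasure hdec]
  refine lintegral_congr fun z => ?_
  rw [enorm_mul, Real.enorm_of_nonneg (hs.nonneg z)]

theorem integrable_shape_mul_iff (hs : IsShapeFunction h) (hdec : IsRadiallyDecreasing h)
    {φ : EuclideanSpace ℝ (Fin n) → ℝ} (hφ : AEStronglyMeasurable φ) :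
    Integrable (fun z => h z * φ z) ↔ ∫⁻ z, ‖φ z‖ₑ ∂shapeMeasure h < ∞ := by
  rw [← lintegral_enorm_shape_mul hs hdec]
  exact ⟨fun H => H.2, fun H => ⟨hdec.measurable.aestronglyMeasurable.mul hφ, H⟩⟩

theorem enorm_markovSmooth_le (hs : IsShapeFunction h) (hdec : IsRadiallyDecreasing h)
    (hΩ : MeasurableSet Ω) (f : EuclideanSpace ℝ (Fin n) → ℝ) {ε d : ℝ} (hε : 0 < ε) (hd : 0 < d)
    {x : EuclideanSpace ℝ (Fin n)} (hx : d ≤ degreeFn h Ω ε x) :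
    ‖markovSmooth h Ω ε f x‖ₑ ≤
      ENNReal.ofReal d⁻¹ * ∫⁻ z, ‖Ω.indicator f (x + ε • z)‖ₑ ∂shapeMeasure h := by
  rw [markovSmooth_eq hΩ f hε, div_eq_inv_mul, enorm_mul,
    ← lintegral_enorm_shape_mul hs hdec (fun z => Ω.indicator f (x + ε • z))]
  gcongr
  · rw [Real.enorm_of_nonneg (inv_nonneg.2 (hd.le.trans hx))]
    gcongr
  · exact enorm_integral_le_lintegral_enorm _

/-- `P_ε` fixes constants on `Ω`, so `f x` can be moved inside the average before taking absolute
values. -/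
theorem enorm_markovSmooth_sub_le (hs : IsShapeFunction h) (hdec : IsRadiallyDecreasing h)
    (hΩ : MeasurableSet Ω) {f : EuclideanSpace ℝ (Fin n) → ℝ}
    (hf : AEStronglyMeasurable (Ω.indicator f)) {ε d : ℝ} (hε : 0 < ε)
    (hd : 0 < d) {x : EuclideanSpace ℝ (Fin n)} (hx : d ≤ degreeFn h Ω ε x) :
    ‖markovSmooth h Ω ε f x - f x‖ₑ ≤ ENNReal.ofReal d⁻¹ *
      ∫⁻ z, ‖Ω.indicator (fun y => f y - f x) (x + ε • z)‖ₑ ∂shapeMeasure h := by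
  -- An infinite right side leaves nothing to prove; a finite one supplies the integrability needed
  -- to split the integral.
  rcases eq_or_ne (∫⁻ z, ‖Ω.indicator (fun y => f y - f x) (x + ε • z)‖ₑ ∂shapeMeasure h) ∞
    with htop | htop
  · rw [htop, ENNReal.mul_top (by simpa using hd)]
    exact le_top
  have hone : AEStronglyMeasurable (Ω.indicator fun _ => (1 : ℝ)) :=
    (measurable_const.indicator hΩ).aestronglyMeasurable
  have hsub : Ω.indicator (fun y => f y - f x) =
      fun y => Ω.indicator f y - f x * Ω.indicator (fun _ => (1 : ℝ)) y := by
    funext y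
    by_cases hy : y ∈ Ω <;> simp [hy]
  have hint1 : Integrable fun z => h z * Ω.indicator (fun y => f y - f x) (x + ε • z) := by
    have hsubm : AEStronglyMeasurable (Ω.indicator fun y => f y - f x) := by
      rw [hsub]
      exact hf.sub (hone.const_mul _)
    exact (integrable_shape_mul_iff hs hdec (hsubm.comp_quasiMeasurePreserving
      (quasiMeasurePreserving_add_smul x hε))).2 htop.lt_top
  have hint2 : Integrable fun z => h z * Ω.indicator (fun _ => (1 : ℝ)) (x + ε • z) := by
    refine integrable_shape_mul_of_bound hs hone (M := 1) (fun y => ?_) hε x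
    by_cases hy : y ∈ Ω <;> simp [hy]
  have hdeg : degreeFn h Ω ε x ≠ 0 := (hd.trans_le hx).ne'
  have key : markovSmooth h Ω ε f x - f x = markovSmooth h Ω ε (fun y => f y - f x) x := by
    have hsum : (fun z => h z * Ω.indicator f (x + ε • z)) = fun z =>
        h z * Ω.indicator (fun y => f y - f x) (x + ε • z) +
          f x * (h z * Ω.indicator (fun _ => (1 : ℝ)) (x + ε • z)) := by
      funext z
      rw [hsub]
      ring
    rw [markovSmooth_eq hΩ f hε, markovSmooth_eq hΩ _ hε, hsum,
      integral_add hint1 (hint2.const_mul _), integral_const_mul, ← degreeFn_eq hs hε]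
    field_simp
    ring
  rw [key]
  exact enorm_markovSmooth_le hs hdec hΩ _ hε hd hx

end ShapeMeasure

/-! ### Jensen's inequality for averages -/

section Jensen

variable {α β : Type*} [MeasurableSpace α] [MeasurableSpace β]

/-- On a probability space the `L¹` norm is at most the `L^p` norm. -/
theorem lintegral_rpow_le_of_isProbabilityMeasure {ν : Measure β} [IsProbabilityMeasure ν]
    {p : ℝ} (hp : 1 ≤ p) {g : β → ℝ≥0∞} (hg : AEMeasurable g ν) :
    (∫⁻ z, g z ∂ν) ^ p ≤ ∫⁻ z, g z ^ p ∂ν := by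
  have hp0 : 0 < p := zero_lt_one.trans_le hp
  have := eLpNorm'_le_eLpNorm'_of_exponent_le one_pos hp ν (f := g) hg.aestronglyMeasurable
  simp only [eLpNorm', enorm_eq_self, ENNReal.rpow_one, one_div, inv_one] at this
  calc _ ≤ ((∫⁻ z, g z ^ p ∂ν) ^ p⁻¹) ^ p := ENNReal.rpow_le_rpow this hp0.le
    _ = _ := by rw [← ENNReal.rpow_mul, inv_mul_cancel₀ hp0.ne', ENNReal.rpow_one]

theorem lintegral_lintegral_rpow_le {μ : Measure α} [SFinite μ] {ν : Measure β}
    [IsProbabilityMeasure ν] {p : ℝ} (hp : 1 ≤ p) {G : α → β → ℝ≥0∞}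
    (hG : Measurable (Function.uncurry G)) :
    ∫⁻ x, (∫⁻ z, G x z ∂ν) ^ p ∂μ ≤ ∫⁻ z, ∫⁻ x, G x z ^ p ∂μ ∂ν := by
  rw [← lintegral_lintegral_swap (hG.pow_const p).aemeasurable]
  refine lintegral_mono fun x => lintegral_rpow_le_of_isProbabilityMeasure hp ?_
  exact (hG.comp measurable_prodMk_left).aemeasurable

end Jensen

/-! ### Uniform boundedness on `L^p` -/

section LpBound

variable {n : ℕ} {h : EuclideanSpace ℝ (Fin n) → ℝ} {Ω : Set (EuclideanSpace ℝ (Fin n))}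

/-- After Jensen and Tonelli, the inner integral for each fixed `z` is that of a translate, hence
independent of `z`. -/
theorem lintegral_shapeAverage_rpow_le (hs : IsShapeFunction h) {p : ℝ} (hp : 1 ≤ p)
    {φ : EuclideanSpace ℝ (Fin n) → ℝ} (hφ : StronglyMeasurable φ) (ε : ℝ) :
    ∫⁻ x, (∫⁻ z, ‖φ (x + ε • z)‖ₑ ∂shapeMeasure h) ^ p ≤ ∫⁻ x, ‖φ x‖ₑ ^ p := by
  have := hs.isProbabilityMeasure
  refine (lintegral_lintegral_rpow_le hp (G := fun x z => ‖φ (x + ε • z)‖ₑ) ?_).trans_eq ?_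
  · exact (hφ.measurable.comp (by fun_prop)).enorm
  · rw [lintegral_congr fun z => lintegral_add_right_eq_self (fun x => ‖φ x‖ₑ ^ p) (ε • z),
      lintegral_const, measure_univ, mul_one]

theorem shapeAverage_le_of_ae_bound (hs : IsShapeFunction h) {φ : EuclideanSpace ℝ (Fin n) → ℝ}
    {M : ℝ≥0∞} (hM : ∀ᵐ y, ‖φ y‖ₑ ≤ M) {ε : ℝ} (hε : 0 < ε) (x : EuclideanSpace ℝ (Fin n)) :
    ∫⁻ z, ‖φ (x + ε • z)‖ₑ ∂shapeMeasure h ≤ M := by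
  have := hs.isProbabilityMeasure
  calc _ ≤ ∫⁻ _, M ∂shapeMeasure h := by
        refine lintegral_mono_ae ((shapeMeasure_absolutelyContinuous h).ae_le ?_)
        exact (quasiMeasurePreserving_add_smul x hε).ae hM
    _ = M := by simp

theorem eLpNorm_shapeAverage_le (hs : IsShapeFunction h) {p : ℝ≥0∞} (hp : 1 ≤ p)
    {φ : EuclideanSpace ℝ (Fin n) → ℝ} (hφ : StronglyMeasurable φ) {ε : ℝ} (hε : 0 < ε) :
    eLpNorm (fun x => ∫⁻ z, ‖φ (x + ε • z)‖ₑ ∂shapeMeasure h) p volume ≤ eLpNorm φ p volume := by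
  rcases eq_or_ne p ∞ with rfl | hp'
  · rw [eLpNorm_exponent_top, eLpNorm_exponent_top]
    refine essSup_le_of_ae_le _ (.of_forall fun x => ?_)
    exact shapeAverage_le_of_ae_bound hs (ae_le_eLpNormEssSup (f := φ)) hε x
  · have hp0 : p ≠ 0 := (zero_lt_one.trans_le hp).ne'
    rw [eLpNorm_eq_lintegral_rpow_enorm_toReal hp0 hp',
      eLpNorm_eq_lintegral_rpow_enorm_toReal hp0 hp']
    refine ENNReal.rpow_le_rpow ?_ (by positivity)
    simp only [enorm_eq_self]
    refine lintegral_shapeAverage_rpow_le hs ?_ hφ ε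
    rwa [← ENNReal.toReal_one, ENNReal.toReal_le_toReal ENNReal.one_ne_top hp']

theorem ae_shapeAverage_lt_top (hs : IsShapeFunction h) {p : ℝ≥0∞} (hp : 1 ≤ p)
    {φ : EuclideanSpace ℝ (Fin n) → ℝ} (hφ : StronglyMeasurable φ) (hφp : MemLp φ p)
    {ε : ℝ} (hε : 0 < ε) :
    ∀ᵐ x, ∫⁻ z, ‖φ (x + ε • z)‖ₑ ∂shapeMeasure h < ∞ := by
  rcases eq_or_ne p ∞ with rfl | hp'
  · refine .of_forall fun x => lt_of_le_of_lt
      (shapeAverage_le_of_ae_bound hs (ae_le_eLpNormEssSup (f := φ)) hε x) ?_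
    simpa using hφp.2
  · have := hs.isProbabilityMeasure
    have hp0 : p ≠ 0 := (zero_lt_one.trans_le hp).ne'
    have hp1 : 1 ≤ p.toReal := by
      rwa [← ENNReal.toReal_one, ENNReal.toReal_le_toReal ENNReal.one_ne_top hp']
    have hmeas : Measurable fun x => ∫⁻ z, ‖φ (x + ε • z)‖ₑ ∂shapeMeasure h :=
      Measurable.lintegral_prod_right' (f := fun q : EuclideanSpace ℝ (Fin n) × _ =>
        ‖φ (q.1 + ε • q.2)‖ₑ) (hφ.measurable.comp (by fun_prop)).enorm
    have hfin : ∫⁻ x, (∫⁻ z, ‖φ (x + ε • z)‖ₑ ∂shapeMeasure h) ^ p.toReal < ∞ :=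
      (lintegral_shapeAverage_rpow_le hs hp1 hφ ε).trans_lt
        (lintegral_rpow_enorm_lt_top_of_eLpNorm_lt_top hp0 hp' hφp.2)
    filter_upwards [ae_lt_top (hmeas.pow_const _) hfin.ne] with x hx
    exact (ENNReal.rpow_lt_top_iff_of_pos (by linarith)).1 hx

theorem stronglyMeasurable_integral_shape_mul (hdec : IsRadiallyDecreasing h)
    {φ : EuclideanSpace ℝ (Fin n) → ℝ} (hφ : StronglyMeasurable φ) (ε : ℝ) :
    StronglyMeasurable fun x => ∫ z, h z * φ (x + ε • z) :=
  StronglyMeasurable.integral_prod_right' (f := fun q : EuclideanSpace ℝ (Fin n) × _ =>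
    h q.2 * φ (q.1 + ε • q.2))
    ((hdec.measurable.comp measurable_snd).mul
      (hφ.measurable.comp (by fun_prop))).stronglyMeasurable

theorem stronglyMeasurable_markovSmooth (hs : IsShapeFunction h) (hdec : IsRadiallyDecreasing h)
    (hΩ : MeasurableSet Ω) {f : EuclideanSpace ℝ (Fin n) → ℝ} (hf : StronglyMeasurable f)
    {ε : ℝ} (hε : 0 < ε) : StronglyMeasurable (markovSmooth h Ω ε f) := by
  have h1 := stronglyMeasurable_integral_shape_mul hdec (hf.indicator hΩ) ε
  have h2 := stronglyMeasurable_integral_shape_mul hdec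
    ((stronglyMeasurable_const (b := (1 : ℝ))).indicator hΩ) ε
  rw [show markovSmooth h Ω ε f = _ from funext fun x => markovSmooth_eq hΩ f hε x]
  refine (h1.measurable.div ?_).stronglyMeasurable
  rw [show degreeFn h Ω ε = _ from funext fun x => degreeFn_eq hs hε x]
  exact h2.measurable

variable {d : ℝ} {ε : ℝ}

theorem eLpNorm_markovSmooth_le (hs : IsShapeFunction h) (hdec : IsRadiallyDecreasing h)
    (hΩ : MeasurableSet Ω) (hε : 0 < ε) (hd : 0 < d) (hdeg : ∀ x ∈ Ω, d ≤ degreeFn h Ω ε x)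
    {p : ℝ≥0∞} (hp : 1 ≤ p) {f : EuclideanSpace ℝ (Fin n) → ℝ}
    (hf : AEStronglyMeasurable f (volume.restrict Ω)) :
    eLpNorm (markovSmooth h Ω ε f) p (volume.restrict Ω) ≤
      ENNReal.ofReal d⁻¹ * eLpNorm f p (volume.restrict Ω) := by
  -- Tonelli needs joint measurability in `(x, z)`, hence a strongly measurable representative.
  rw [markovSmooth_congr_ae hf.ae_eq_mk, eLpNorm_congr_ae hf.ae_eq_mk]
  set g := hf.mk f with hg
  have hgm : StronglyMeasurable g := hf.stronglyMeasurable_mk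
  rw [← eLpNorm_indicator_eq_eLpNorm_restrict (f := g) hΩ]
  calc _ ≤ ENNReal.ofReal d⁻¹ * eLpNorm (fun x => ∫⁻ z, ‖Ω.indicator g (x + ε • z)‖ₑ
          ∂shapeMeasure h) p (volume.restrict Ω) := by
        rw [← Real.enorm_of_nonneg (inv_pos.2 hd).le]
        refine eLpNorm_le_nnreal_smul_eLpNorm_of_ae_le_mul' (c := ‖d⁻¹‖₊) ?_ p
        filter_upwards [ae_restrict_mem hΩ] with x hx
        have := enorm_markovSmooth_le hs hdec hΩ g hε hd (hdeg x hx)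
        rwa [← Real.enorm_of_nonneg (inv_pos.2 hd).le] at this
    _ ≤ _ := by
        gcongr
        refine (eLpNorm_mono_measure _ Measure.restrict_le_self).trans ?_
        exact eLpNorm_shapeAverage_le hs hp (hgm.indicator hΩ) hε

theorem memLp_markovSmooth (hs : IsShapeFunction h) (hdec : IsRadiallyDecreasing h)
    (hΩ : MeasurableSet Ω) (hε : 0 < ε) (hd : 0 < d) (hdeg : ∀ x ∈ Ω, d ≤ degreeFn h Ω ε x)
    {p : ℝ≥0∞} (hp : 1 ≤ p) {f : EuclideanSpace ℝ (Fin n) → ℝ}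
    (hf : MemLp f p (volume.restrict Ω)) :
    MemLp (markovSmooth h Ω ε f) p (volume.restrict Ω) := by
  refine ⟨?_, (eLpNorm_markovSmooth_le hs hdec hΩ hε hd hdeg hp hf.1).trans_lt
    (ENNReal.mul_lt_top ENNReal.ofReal_lt_top hf.2)⟩
  rw [markovSmooth_congr_ae hf.1.ae_eq_mk]
  exact (stronglyMeasurable_markovSmooth hs hdec hΩ hf.1.stronglyMeasurable_mk
    hε).aestronglyMeasurable

theorem ae_integrableOn_markovKernel_mul (hs : IsShapeFunction h) (hdec : IsRadiallyDecreasing h)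
    (hΩ : MeasurableSet Ω) (hε : 0 < ε) {p : ℝ≥0∞} (hp : 1 ≤ p)
    {f : EuclideanSpace ℝ (Fin n) → ℝ} (hf : MemLp f p (volume.restrict Ω)) :
    ∀ᵐ x, IntegrableOn (fun y => markovKernel h Ω ε x y * f y) Ω := by
  set g := hf.1.mk f with hg
  have hgm : StronglyMeasurable g := hf.1.stronglyMeasurable_mk
  have hgp : MemLp (Ω.indicator g) p volume :=
    (memLp_indicator_iff_restrict hΩ).2 (hf.ae_eq hf.1.ae_eq_mk)
  filter_upwards [ae_shapeAverage_lt_top hs hp (hgm.indicator hΩ) hgp hε] with x hx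
  have hint : IntegrableOn (fun y => markovKernel h Ω ε x y * g y) Ω := by
    refine integrableOn_markovKernel_mul hΩ hε ((integrable_shape_mul_iff hs hdec ?_).2 hx)
    exact hgp.1.comp_quasiMeasurePreserving (quasiMeasurePreserving_add_smul x hε)
  refine hint.congr ?_
  filter_upwards [hf.1.ae_eq_mk] with y hy
  rw [hy]

theorem exists_markovSmooth_Lp (hs : IsShapeFunction h) (hdec : IsRadiallyDecreasing h)
    (hΩ : MeasurableSet Ω) (hε : 0 < ε) (hd : 0 < d) (hdeg : ∀ x ∈ Ω, d ≤ degreeFn h Ω ε x)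
    (p : ℝ≥0∞) [hp : Fact (1 ≤ p)] :
    ∃ T : Lp ℝ p (volume.restrict Ω) →L[ℝ] Lp ℝ p (volume.restrict Ω), ‖T‖ ≤ d⁻¹ ∧
      ∀ f : Lp ℝ p (volume.restrict Ω),
        (∀ᵐ x ∂(volume.restrict Ω),
          IntegrableOn (fun y => markovKernel h Ω ε x y * f y) Ω volume) ∧
        T f =ᵐ[volume.restrict Ω] markovSmooth h Ω ε f := by
  have hint (f : Lp ℝ p (volume.restrict Ω)) : ∀ᵐ x ∂(volume.restrict Ω),
      IntegrableOn (fun y => markovKernel h Ω ε x y * f y) Ω volume :=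
    ae_restrict_of_ae (ae_integrableOn_markovKernel_mul hs hdec hΩ hε hp.out (Lp.memLp f))
  have hmem (f : Lp ℝ p (volume.restrict Ω)) :
      MemLp (markovSmooth h Ω ε f) p (volume.restrict Ω) :=
    memLp_markovSmooth hs hdec hΩ hε hd hdeg hp.out (Lp.memLp f)
  let T : Lp ℝ p (volume.restrict Ω) →ₗ[ℝ] Lp ℝ p (volume.restrict Ω) :=
    { toFun := fun f => (hmem f).toLp _
      -- Additivity is only a.e.: it holds at points where both integrals converge absolutely.
      map_add' := fun f g => by
        apply Lp.ext
        filter_upwards [(hmem (f + g)).coeFn_toLp, (hmem f).coeFn_toLp, (hmem g).coeFn_toLp,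
          Lp.coeFn_add ((hmem f).toLp _) ((hmem g).toLp _), hint f, hint g]
          with x h1 h2 h3 h4 h5 h6
        rw [h1, h4, Pi.add_apply, h2, h3, markovSmooth_congr_ae (Lp.coeFn_add f g)]
        unfold markovSmooth
        rw [← integral_add h5 h6]
        simp only [Pi.add_apply, mul_add]
      map_smul' := fun c f => by
        apply Lp.ext
        filter_upwards [(hmem (c • f)).coeFn_toLp, (hmem f).coeFn_toLp,
          Lp.coeFn_smul c ((hmem f).toLp _)] with x h1 h2 h3
        rw [h1, RingHom.id_apply, h3, Pi.smul_apply, h2,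
          markovSmooth_congr_ae (Lp.coeFn_smul c f)]
        unfold markovSmooth
        rw [smul_eq_mul, ← integral_const_mul]
        simp only [Pi.smul_apply, smul_eq_mul, mul_left_comm] }
  refine ⟨T.mkContinuous d⁻¹ fun f => ?_, T.mkContinuous_norm_le (by positivity) _,
    fun f => ⟨hint f, (hmem f).coeFn_toLp⟩⟩
  change ‖(hmem f).toLp _‖ ≤ _
  rw [Lp.norm_toLp, Lp.norm_def, ← ENNReal.toReal_ofReal (inv_pos.2 hd).le,
    ← ENNReal.toReal_mul]
  exact ENNReal.toReal_mono (ENNReal.mul_ne_top ENNReal.ofReal_ne_top (Lp.eLpNorm_ne_top f))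
    (eLpNorm_markovSmooth_le hs hdec hΩ hε hd hdeg hp.out (Lp.aestronglyMeasurable f))

end LpBound

/-! ### Continuity of translation in `L^p` -/

section Translation

variable {n : ℕ}

theorem continuous_mk_vadd_toLp {F : Type*} [NormedAddCommGroup F] {p : ℝ≥0∞} [Fact (1 ≤ p)]
    (hp : p ≠ ∞) (g : Lp F p (volume : Measure (EuclideanSpace ℝ (Fin n)))) :
    Continuous fun c : EuclideanSpace ℝ (Fin n) => DomAddAct.mk c +ᵥ g := by
  have : Fact (p ≠ ∞) := ⟨hp⟩
  have hmk : Continuous (DomAddAct.mk : EuclideanSpace ℝ (Fin n) → _) :=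
    DomAddAct.continuous_mk
  fun_prop

theorem tendsto_eLpNorm_translate_sub {p : ℝ≥0∞} (hp1 : 1 ≤ p) (hp : p ≠ ∞)
    {g : EuclideanSpace ℝ (Fin n) → ℝ} (hg : MemLp g p) :
    Tendsto (fun c => eLpNorm (fun x => g (x + c) - g x) p volume) (𝓝 0) (𝓝 0) := by
  have : Fact (1 ≤ p) := ⟨hp1⟩
  have h1 := (continuous_mk_vadd_toLp hp (hg.toLp g)).tendsto 0
  have h2 : Tendsto (fun c : EuclideanSpace ℝ (Fin n) =>
      (hg.comp_measurePreserving (measurePreserving_vadd c volume)).toLp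
        (g <| c +ᵥ ·)) (𝓝 0) (𝓝 (hg.toLp g)) := by
    have h0 : (DomAddAct.mk (0 : EuclideanSpace ℝ (Fin n)) +ᵥ hg.toLp g) = hg.toLp g := by
      rw [DomAddAct.mk_zero, zero_vadd]
    rw [h0] at h1
    exact h1
  rw [Lp.tendsto_Lp_iff_tendsto_eLpNorm''] at h2
  refine h2.congr fun c => ?_
  congr 1
  funext x
  simp [add_comm]

end Translation

/-! ### Convergence in norm -/

section NormConvergence

variable {n : ℕ} {h : EuclideanSpace ℝ (Fin n) → ℝ} {Ω : Set (EuclideanSpace ℝ (Fin n))}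

theorem tendsto_lintegral_shapeAverage_sub (hs : IsShapeFunction h) {p : ℝ≥0∞} (hp1 : 1 ≤ p)
    (hp : p ≠ ∞) {g : EuclideanSpace ℝ (Fin n) → ℝ} (hgm : StronglyMeasurable g)
    (hg : MemLp g p) :
    Tendsto (fun ε : ℝ => eLpNorm (fun x => ∫⁻ z, ‖g (x + ε • z) - g x‖ₑ ∂shapeMeasure h) p volume)
      (𝓝[>] 0) (𝓝 0) := by
  have := hs.isProbabilityMeasure
  have hp0 : p ≠ 0 := (zero_lt_one.trans_le hp1).ne'
  have hp1' : 1 ≤ p.toReal := by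
    rwa [← ENNReal.toReal_one, ENNReal.toReal_le_toReal ENNReal.one_ne_top hp]
  have hppos : 0 < p.toReal := by linarith
  have hmeas (ε : ℝ) : Measurable (Function.uncurry
      fun x z : EuclideanSpace ℝ (Fin n) => ‖g (x + ε • z) - g x‖ₑ) :=
    ((hgm.measurable.comp (f := fun q : EuclideanSpace ℝ (Fin n) × EuclideanSpace ℝ (Fin n) =>
      q.1 + ε • q.2) (by fun_prop)).sub (hgm.measurable.comp measurable_fst)).enorm
  have hrpow (ε : ℝ) (z : EuclideanSpace ℝ (Fin n)) :
      ∫⁻ x, ‖g (x + ε • z) - g x‖ₑ ^ p.toReal =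
        eLpNorm (fun x => g (x + ε • z) - g x) p volume ^ p.toReal := by
    rw [eLpNorm_eq_lintegral_rpow_enorm_toReal hp0 hp, ← ENNReal.rpow_mul,
      one_div_mul_cancel hppos.ne', ENNReal.rpow_one]
  have hbound (ε : ℝ) (z : EuclideanSpace ℝ (Fin n)) :
      eLpNorm (fun x => g (x + ε • z) - g x) p volume ≤ 2 * eLpNorm g p volume := by
    have hmp := measurePreserving_add_right (volume : Measure (EuclideanSpace ℝ (Fin n))) (ε • z)
    have hshift : eLpNorm (fun x => g (x + ε • z)) p volume = eLpNorm g p volume :=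
      eLpNorm_comp_measurePreserving hg.1 hmp
    refine (eLpNorm_sub_le (f := fun x => g (x + ε • z))
      (hg.1.comp_measurePreserving hmp) hg.1 hp1).trans ?_
    rw [hshift, two_mul]
  have hlim : Tendsto (fun ε : ℝ => ∫⁻ z, ∫⁻ x, ‖g (x + ε • z) - g x‖ₑ ^ p.toReal
      ∂volume ∂shapeMeasure h) (𝓝[>] 0) (𝓝 (∫⁻ _, 0 ∂shapeMeasure h)) := by
    -- The dominating function is constant in `z`, hence integrable against a probability measure.
    refine tendsto_lintegral_filter_of_dominated_convergence
      (fun _ => (2 * eLpNorm g p volume) ^ p.toReal) (.of_forall fun ε => ?_)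
      (.of_forall fun ε => .of_forall fun z => ?_) ?_ (.of_forall fun z => ?_)
    · exact ((hmeas ε).pow_const _).lintegral_prod_left'
    · rw [hrpow]
      gcongr
      exact hbound ε z
    · rw [lintegral_const, measure_univ, mul_one]
      exact ENNReal.rpow_ne_top_of_nonneg hppos.le
        (ENNReal.mul_ne_top ENNReal.ofNat_ne_top hg.2.ne)
    · have hz : Tendsto (fun ε : ℝ => ε • z) (𝓝[>] 0) (𝓝 0) := by
        have : Continuous fun ε : ℝ => ε • z := by fun_prop
        simpa using (this.tendsto 0).mono_left nhdsWithin_le_nhds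
      have := ((tendsto_eLpNorm_translate_sub hp1 hp hg).comp hz).ennrpow_const p.toReal
      rw [ENNReal.zero_rpow_of_pos hppos] at this
      exact this.congr fun ε => (hrpow ε z).symm
  rw [lintegral_zero] at hlim
  have hlim' := hlim.ennrpow_const (1 / p.toReal)
  rw [ENNReal.zero_rpow_of_pos (by positivity)] at hlim'
  refine tendsto_of_tendsto_of_tendsto_of_le_of_le tendsto_const_nhds hlim'
    (fun _ => zero_le) fun ε => ?_
  rw [eLpNorm_eq_lintegral_rpow_enorm_toReal hp0 hp]
  refine ENNReal.rpow_le_rpow ?_ (by positivity)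
  simp only [enorm_eq_self]
  exact lintegral_lintegral_rpow_le hp1' (hmeas ε)

theorem tendsto_eLpNorm_markovSmooth_sub (hs : IsShapeFunction h) (hdec : IsRadiallyDecreasing h)
    (hΩ : MeasurableSet Ω) {d ε₀ : ℝ} (hd : 0 < d) (hε₀ : 0 < ε₀)
    (hdeg : ∀ ε, 0 < ε → ε < ε₀ → ∀ x ∈ Ω, d ≤ degreeFn h Ω ε x)
    {p : ℝ≥0∞} (hp1 : 1 ≤ p) (hp : p ≠ ∞)
    {f : EuclideanSpace ℝ (Fin n) → ℝ} (hf : MemLp f p (volume.restrict Ω)) :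
    Tendsto (fun ε => eLpNorm (fun x => markovSmooth h Ω ε f x - f x) p (volume.restrict Ω))
      (𝓝[>] 0) (𝓝 0) := by
  -- The zero extension lies in `L^p` of the whole space, where translation acts.
  set g := Ω.indicator (hf.1.mk f) with hg
  have hgm : StronglyMeasurable g := hf.1.stronglyMeasurable_mk.indicator hΩ
  have hfg : f =ᵐ[volume.restrict Ω] g :=
    hf.1.ae_eq_mk.trans (indicator_ae_eq_restrict hΩ).symm
  have hgΩ : Ω.indicator g = g := by rw [hg, Set.indicator_indicator, Set.inter_self]
  have hgp : MemLp g p volume := by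
    rw [← hgΩ]
    exact (memLp_indicator_iff_restrict hΩ).2 (hf.ae_eq hfg)
  have hlim := (ENNReal.Tendsto.const_mul (tendsto_lintegral_shapeAverage_sub hs hp1 hp hgm hgp)
    (.inr (ENNReal.ofReal_ne_top (r := d⁻¹))))
  rw [mul_zero] at hlim
  refine tendsto_of_tendsto_of_tendsto_of_le_of_le' tendsto_const_nhds hlim
    (.of_forall fun _ => zero_le) ?_
  filter_upwards [Ioo_mem_nhdsGT hε₀] with ε hε
  have hcongr : (fun x => markovSmooth h Ω ε f x - f x) =ᵐ[volume.restrict Ω]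
      fun x => markovSmooth h Ω ε g x - g x := by
    filter_upwards [hfg] with x hx
    rw [hx, markovSmooth_congr_ae hfg]
  rw [eLpNorm_congr_ae hcongr]
  refine le_trans (b := ENNReal.ofReal d⁻¹ * eLpNorm (fun x => ∫⁻ z, ‖g (x + ε • z) - g x‖ₑ
          ∂shapeMeasure h) p (volume.restrict Ω)) ?_
    (mul_le_mul_right (eLpNorm_mono_measure _ Measure.restrict_le_self) _)
  rw [← Real.enorm_of_nonneg (inv_pos.2 hd).le]
  refine eLpNorm_le_nnreal_smul_eLpNorm_of_ae_le_mul' (c := ‖d⁻¹‖₊) ?_ p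
  filter_upwards [ae_restrict_mem hΩ] with x hx
  have := enorm_markovSmooth_sub_le hs hdec hΩ (f := g) (by rw [hgΩ]; exact hgp.1)
     hε.1 hd (hdeg ε hε.1 hε.2 x hx)
  rw [← Real.enorm_of_nonneg (inv_pos.2 hd).le] at this
  refine this.trans ?_
  change _ ≤ ‖d⁻¹‖ₑ * _
  rw [enorm_eq_self]
  gcongr with z
  by_cases hz : x + ε • z ∈ Ω <;> simp [hz]

end NormConvergence

/-! ### Dyadic majorant of the shape function -/

section DyadicMajorant

variable {n : ℕ} {h : EuclideanSpace ℝ (Fin n) → ℝ} {C δ : ℝ}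

/-- The height over the ball of radius `2 ^ k` of a step function which dominates
`C (1 + ‖x‖) ^ (-(n + δ))`. -/
noncomputable def dyadicHeight (n : ℕ) (C δ : ℝ) (k : ℕ) : ℝ :=
  C * 2 ^ ((n : ℝ) + δ) * (2 ^ (-δ)) ^ k * (((2 : ℝ) ^ k) ^ n)⁻¹

theorem dyadicHeight_nonneg (hC : 0 < C) (k : ℕ) : 0 ≤ dyadicHeight n C δ k := by
  unfold dyadicHeight
  positivity

/-- The factor `2 ^ (n + δ)` in the height absorbs the index shift: the height over radius `2 ^ (k +
1)` is the decay bound at the inner radius `2 ^ k` of the annulus. -/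
theorem dyadicHeight_succ (k : ℕ) :
    dyadicHeight n C δ (k + 1) = C * ((2 : ℝ) ^ k) ^ (-((n : ℝ) + δ)) := by
  have h2 : (0 : ℝ) < 2 := two_pos
  unfold dyadicHeight
  rw [← Real.rpow_natCast (_ ^ (k + 1)) n, ← Real.rpow_natCast _ (k + 1),
    ← Real.rpow_natCast _ (k + 1), ← Real.rpow_natCast _ k, ← Real.rpow_mul h2.le,
    ← Real.rpow_mul h2.le, ← Real.rpow_mul h2.le, ← Real.rpow_neg h2.le, mul_assoc, mul_assoc,
    ← Real.rpow_add h2, ← Real.rpow_add h2]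
  congr 2
  push_cast
  ring

theorem exists_le_dyadicHeight (hC : 0 < C) (hδ : 0 < δ)
    (hdecay : ∀ x, |h x| ≤ C * (1 + ‖x‖) ^ (-((n : ℝ) + δ))) (z : EuclideanSpace ℝ (Fin n)) :
    ∃ k : ℕ, ‖z‖ ≤ 2 ^ k ∧ h z ≤ dyadicHeight n C δ k := by
  have hs : 0 ≤ (n : ℝ) + δ := by positivity
  rcases lt_or_ge ‖z‖ 1 with hz | hz
  · refine ⟨0, by simpa using hz.le, (le_abs_self _).trans ((hdecay z).trans ?_)⟩
    have h1 : (1 + ‖z‖) ^ (-((n : ℝ) + δ)) ≤ 1 :=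
      Real.rpow_le_one_of_one_le_of_nonpos (by linarith [norm_nonneg z]) (by linarith)
    have h2 : (1 : ℝ) ≤ 2 ^ ((n : ℝ) + δ) := Real.one_le_rpow one_le_two hs
    simp only [dyadicHeight, pow_zero, one_pow, inv_one, mul_one]
    gcongr
    exact h1.trans h2
  · obtain ⟨k, hk1, hk2⟩ := exists_nat_pow_near hz (one_lt_two : (1 : ℝ) < 2)
    refine ⟨k + 1, hk2.le, (le_abs_self _).trans ((hdecay z).trans ?_)⟩
    rw [dyadicHeight_succ]
    exact mul_le_mul_of_nonneg_left
      (Real.rpow_le_rpow_of_nonpos (by positivity) (by linarith) (by linarith)) hC.le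

theorem ofReal_le_tsum_dyadicHeight (hC : 0 < C) (hδ : 0 < δ)
    (hdecay : ∀ x, |h x| ≤ C * (1 + ‖x‖) ^ (-((n : ℝ) + δ))) (z : EuclideanSpace ℝ (Fin n)) :
    ENNReal.ofReal (h z) ≤ ∑' k : ℕ, (closedBall (0 : EuclideanSpace ℝ (Fin n)) (2 ^ k)).indicator
      (fun _ => ENNReal.ofReal (dyadicHeight n C δ k)) z := by
  obtain ⟨k, hk, hle⟩ := exists_le_dyadicHeight hC hδ hdecay z
  refine le_trans ?_ (ENNReal.le_tsum k)
  rw [Set.indicator_of_mem (by simpa using hk)]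
  exact ENNReal.ofReal_le_ofReal hle

/-- Integrating an indicator of the majorant gives a ball average; the ball volume cancels the
factor `2 ^ (-k n)` of the height, leaving geometric weights `2 ^ (-δ k)`. -/
theorem lintegral_shapeMeasure_le_tsum (hdec : IsRadiallyDecreasing h) (hC : 0 < C) (hδ : 0 < δ)
    (hdecay : ∀ x, |h x| ≤ C * (1 + ‖x‖) ^ (-((n : ℝ) + δ)))
    {G : EuclideanSpace ℝ (Fin n) → ℝ≥0∞} (hG : Measurable G) (x : EuclideanSpace ℝ (Fin n))
    {ε : ℝ} (hε : 0 < ε) :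
    ∫⁻ z, G (x + ε • z) ∂shapeMeasure h ≤
      ∑' k : ℕ, ENNReal.ofReal (C * 2 ^ ((n : ℝ) + δ) * (2 ^ (-δ)) ^ k) *
        volume (ball (0 : EuclideanSpace ℝ (Fin n)) 1) *
        ((∫⁻ y in closedBall x (ε * 2 ^ k), G y) / volume (closedBall x (ε * 2 ^ k))) := by
  have hGm : Measurable fun z => G (x + ε • z) := hG.comp (by fun_prop)
  rw [lintegral_shapeMeasure hdec]
  calc _ ≤ ∫⁻ z, ∑' k : ℕ, (closedBall (0 : EuclideanSpace ℝ (Fin n)) (2 ^ k)).indicator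
          (fun _ => ENNReal.ofReal (dyadicHeight n C δ k)) z * G (x + ε • z) := by
        refine lintegral_mono fun z => ?_
        rw [ENNReal.tsum_mul_right]
        gcongr
        exact ofReal_le_tsum_dyadicHeight hC hδ hdecay z
    _ = ∑' k : ℕ, ∫⁻ z, (closedBall (0 : EuclideanSpace ℝ (Fin n)) (2 ^ k)).indicator
          (fun _ => ENNReal.ofReal (dyadicHeight n C δ k)) z * G (x + ε • z) :=
        lintegral_tsum fun k =>
          ((measurable_const.indicator measurableSet_closedBall).mul hGm).aemeasurable
    _ = _ := by
        refine tsum_congr fun k => ?_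
        have hr : 0 < ε * 2 ^ k := by positivity
        have hV0 : volume (closedBall x (ε * 2 ^ k)) ≠ 0 := (measure_closedBall_pos _ _ hr).ne'
        have hVtop : volume (closedBall x (ε * 2 ^ k)) ≠ ∞ := measure_closedBall_lt_top.ne
        have hfun : (fun z => (closedBall (0 : EuclideanSpace ℝ (Fin n)) (2 ^ k)).indicator
            (fun _ => ENNReal.ofReal (dyadicHeight n C δ k)) z * G (x + ε • z)) =
            fun z => ENNReal.ofReal (dyadicHeight n C δ k) *
              (closedBall x (ε * 2 ^ k)).indicator G (x + ε • z) := by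
          funext z
          have hmem : x + ε • z ∈ closedBall x (ε * 2 ^ k) ↔
              z ∈ closedBall (0 : EuclideanSpace ℝ (Fin n)) (2 ^ k) := by
            simp only [mem_closedBall, dist_zero_right, dist_self_add_left, norm_smul,
              Real.norm_of_nonneg hε.le, mul_le_mul_iff_right₀ hε]
          by_cases hz : z ∈ closedBall (0 : EuclideanSpace ℝ (Fin n)) (2 ^ k)
          · rw [Set.indicator_of_mem hz, Set.indicator_of_mem (hmem.2 hz)]
          · rw [Set.indicator_of_notMem hz, Set.indicator_of_notMem (mt hmem.1 hz), zero_mul,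
              mul_zero]
        have hcoef : ENNReal.ofReal (dyadicHeight n C δ k) * (ENNReal.ofReal (ε ^ n)⁻¹ *
            volume (closedBall x (ε * 2 ^ k))) =
            ENNReal.ofReal (C * 2 ^ ((n : ℝ) + δ) * (2 ^ (-δ)) ^ k) *
              volume (ball (0 : EuclideanSpace ℝ (Fin n)) 1) := by
          rw [Measure.addHaar_closedBall volume x hr.le, finrank_euclideanSpace_fin,
            ← mul_assoc, ← mul_assoc, ← ENNReal.ofReal_mul (dyadicHeight_nonneg hC k),
            ← ENNReal.ofReal_mul (mul_nonneg (dyadicHeight_nonneg hC k) (by positivity))]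
          congr 2
          unfold dyadicHeight
          rw [mul_pow]
          field_simp
        rw [hfun, lintegral_const_mul' _ _ ENNReal.ofReal_ne_top, lintegral_comp_add_smul x hε,
          lintegral_indicator measurableSet_closedBall, ← hcoef]
        rw [mul_assoc, mul_assoc, ENNReal.mul_div_cancel hV0 hVtop]

theorem tendsto_shapeAverage_zero (hdec : IsRadiallyDecreasing h) (hC : 0 < C) (hδ : 0 < δ)
    (hdecay : ∀ x, |h x| ≤ C * (1 + ‖x‖) ^ (-((n : ℝ) + δ)))
    {G : EuclideanSpace ℝ (Fin n) → ℝ≥0∞} (hG : Measurable G) {x : EuclideanSpace ℝ (Fin n)}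
    (hlim : Tendsto (fun r => (∫⁻ y in closedBall x r, G y) / volume (closedBall x r))
      (𝓝[>] 0) (𝓝 0)) {M : ℝ≥0∞} (hM : M ≠ ∞)
    (hbound : ∀ r > 0, (∫⁻ y in closedBall x r, G y) / volume (closedBall x r) ≤ M) :
    Tendsto (fun ε : ℝ => ∫⁻ z, G (x + ε • z) ∂shapeMeasure h) (𝓝[>] 0) (𝓝 0) := by
  set V := volume (ball (0 : EuclideanSpace ℝ (Fin n)) 1) with hV
  have hVtop : V ≠ ∞ := measure_ball_lt_top.ne
  set a : ℕ → ℝ := fun k => C * 2 ^ ((n : ℝ) + δ) * (2 ^ (-δ)) ^ k with ha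
  have ha0 (k : ℕ) : 0 ≤ a k := by positivity
  have hasum : Summable a := by
    refine (summable_geometric_of_lt_one (by positivity) ?_).mul_left _
    exact Real.rpow_lt_one_of_one_lt_of_neg one_lt_two (by linarith)
  -- Dominated convergence for series, as an integral against counting measure.
  have key : Tendsto (fun ε : ℝ => ∫⁻ k : ℕ, ENNReal.ofReal (a k) * V *
      ((∫⁻ y in closedBall x (ε * 2 ^ k), G y) / volume (closedBall x (ε * 2 ^ k)))
      ∂Measure.count) (𝓝[>] 0) (𝓝 (∫⁻ _ : ℕ, 0 ∂Measure.count)) := by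
    refine tendsto_lintegral_filter_of_dominated_convergence
      (fun k => ENNReal.ofReal (a k) * V * M) (.of_forall fun ε => Measurable.of_discrete)
      ?_ ?_ (.of_forall fun k => ?_)
    · filter_upwards [self_mem_nhdsWithin] with ε hε
      refine .of_forall fun k => ?_
      gcongr
      exact hbound _ (mul_pos (Set.mem_Ioi.1 hε) (by positivity))
    · rw [lintegral_count, ENNReal.tsum_mul_right, ENNReal.tsum_mul_right]
      exact ENNReal.mul_ne_top (ENNReal.mul_ne_top hasum.tsum_ofReal_ne_top hVtop) hM
    · have hk : Tendsto (fun ε : ℝ => ε * 2 ^ k) (𝓝[>] 0) (𝓝[>] 0) := by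
        refine tendsto_nhdsWithin_iff.2 ⟨?_, ?_⟩
        · have : Continuous fun ε : ℝ => ε * 2 ^ k := by fun_prop
          simpa using (this.tendsto 0).mono_left nhdsWithin_le_nhds
        · filter_upwards [self_mem_nhdsWithin] with ε hε
          exact mul_pos (Set.mem_Ioi.1 hε) (by positivity)
      have := ENNReal.Tendsto.const_mul (hlim.comp hk)
        (.inr (ENNReal.mul_ne_top (ENNReal.ofReal_ne_top (r := a k)) hVtop))
      rwa [mul_zero] at this
  rw [lintegral_zero] at key
  refine tendsto_of_tendsto_of_tendsto_of_le_of_le' tendsto_const_nhds key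
    (.of_forall fun _ => zero_le) ?_
  filter_upwards [self_mem_nhdsWithin] with ε hε
  rw [lintegral_count]
  exact lintegral_shapeMeasure_le_tsum hdec hC hδ hdecay hG x hε

end DyadicMajorant

/-! ### Convergence at Lebesgue points -/

section PointwiseConvergence

variable {n : ℕ} {h : EuclideanSpace ℝ (Fin n) → ℝ} {Ω : Set (EuclideanSpace ℝ (Fin n))}

/-- For finite `p`, `t ≤ 1 + t ^ p`; for `p = ∞` the essential supremum serves as `K`. -/
theorem MeasureTheory.MemLp.exists_enorm_le_add {α : Type*} [MeasurableSpace α] {μ : Measure α}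
    {p : ℝ≥0∞} (hp : 1 ≤ p) {g : α → ℝ} (hg : MemLp g p μ) :
    ∃ K : ℝ≥0∞, K ≠ ∞ ∧ ∃ w : α → ℝ≥0∞, ∫⁻ y, w y ∂μ ≠ ∞ ∧ ∀ᵐ y ∂μ, ‖g y‖ₑ ≤ K + w y := by
  rcases eq_or_ne p ∞ with rfl | hp'
  · refine ⟨eLpNormEssSup g μ, by simpa using hg.2.ne, 0, by simp, ?_⟩
    filter_upwards [ae_le_eLpNormEssSup (f := g) (μ := μ)] with y hy
    simpa using hy
  · have hp0 : p ≠ 0 := (zero_lt_one.trans_le hp).ne'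
    have hp1 : 1 ≤ p.toReal := by
      rwa [← ENNReal.toReal_one, ENNReal.toReal_le_toReal ENNReal.one_ne_top hp']
    refine ⟨1, ENNReal.one_ne_top, fun y => ‖g y‖ₑ ^ p.toReal,
      (lintegral_rpow_enorm_lt_top_of_eLpNorm_lt_top hp0 hp' hg.2).ne, .of_forall fun y => ?_⟩
    rcases le_total ‖g y‖ₑ 1 with h1 | h1
    · exact h1.trans le_self_add
    · exact (ENNReal.le_rpow_self_of_one_le h1 hp1).trans le_add_self

/-- Small radii are controlled by the limit at a Lebesgue point, large ones by splitting `g` into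
bounded and integrable parts. This finite bound at each such point suffices without a maximal
inequality. -/
theorem exists_laverage_le {p : ℝ≥0∞} (hp : 1 ≤ p) {g : EuclideanSpace ℝ (Fin n) → ℝ}
    (hg : MemLp g p) (x : EuclideanSpace ℝ (Fin n))
    (hlim : Tendsto (fun r => (∫⁻ y in closedBall x r, ‖g y - g x‖ₑ) / volume (closedBall x r))
      (𝓝[>] 0) (𝓝 0)) :
    ∃ M : ℝ≥0∞, M ≠ ∞ ∧
      ∀ r > 0, (∫⁻ y in closedBall x r, ‖g y - g x‖ₑ) / volume (closedBall x r) ≤ M := by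
  obtain ⟨K, hK, w, hw, hle⟩ := hg.exists_enorm_le_add hp
  have hev := hlim.eventually (gt_mem_nhds zero_lt_one)
  obtain ⟨r₀, hr₀, hsmall⟩ := mem_nhdsGT_iff_exists_Ioo_subset.1 hev
  have hV0 : volume (closedBall x r₀) ≠ 0 := (measure_closedBall_pos _ _ hr₀).ne'
  refine ⟨1 + (K + ‖g x‖ₑ + (∫⁻ y, w y) / volume (closedBall x r₀)), by finiteness,
    fun r hr => ?_⟩
  rcases lt_or_ge r r₀ with hrr | hrr
  · exact (hsmall ⟨hr, hrr⟩).le.trans le_self_add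
  · refine le_trans ?_ le_add_self
    have hVr0 : volume (closedBall x r) ≠ 0 := (measure_closedBall_pos _ _ hr).ne'
    have hVrtop : volume (closedBall x r) ≠ ∞ := measure_closedBall_lt_top.ne
    calc _ ≤ ((K + ‖g x‖ₑ) * volume (closedBall x r) + ∫⁻ y, w y) / volume (closedBall x r) := by
          gcongr
          calc _ ≤ ∫⁻ y in closedBall x r, ((K + ‖g x‖ₑ) + w y) := by
                refine lintegral_mono_ae (ae_restrict_of_ae ?_)
                filter_upwards [hle] with y hy
                calc _ ≤ ‖g y‖ₑ + ‖g x‖ₑ := enorm_sub_le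
                  _ ≤ (K + w y) + ‖g x‖ₑ := by gcongr
                  _ = _ := by ring
            _ ≤ _ := by
                rw [lintegral_add_left measurable_const, setLIntegral_const]
                gcongr
                exact Measure.restrict_le_self
      _ = (K + ‖g x‖ₑ) + (∫⁻ y, w y) / volume (closedBall x r) := by
          rw [ENNReal.add_div, ENNReal.mul_div_cancel_right hVr0 hVrtop]
      _ ≤ _ := by gcongr

theorem ae_tendsto_laverage_enorm_sub {g : EuclideanSpace ℝ (Fin n) → ℝ}
    (hg : LocallyIntegrable g) :
    ∀ᵐ x, Tendsto (fun r => (∫⁻ y in closedBall x r, ‖g y - g x‖ₑ) / volume (closedBall x r))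
      (𝓝[>] 0) (𝓝 0) := by
  filter_upwards [IsUnifLocDoublingMeasure.ae_tendsto_average_norm_sub volume hg 1] with x hx
  have := hx (l := 𝓝[>] 0) (fun _ => x) id tendsto_id (by
    filter_upwards [self_mem_nhdsWithin] with r hr
    simpa using (le_of_lt hr : (0 : ℝ) ≤ r))
  have := (ENNReal.continuous_ofReal.tendsto 0).comp this
  rw [ENNReal.ofReal_zero] at this
  refine this.congr' ?_
  filter_upwards [self_mem_nhdsWithin] with r hr
  rw [Function.comp_apply, ofReal_setAverage]
  · simp only [ofReal_norm, id]
  · exact ((hg.integrableOn_isCompact (isCompact_closedBall x r)).sub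
      (integrableOn_const measure_closedBall_lt_top.ne)).norm
  · exact .of_forall fun _ => norm_nonneg _

theorem ae_tendsto_markovSmooth (hs : IsShapeFunction h) (hdec : IsRadiallyDecreasing h)
    (hΩ : MeasurableSet Ω) {d ε₀ : ℝ} (hd : 0 < d) (hε₀ : 0 < ε₀)
    (hdeg : ∀ ε, 0 < ε → ε < ε₀ → ∀ x ∈ Ω, d ≤ degreeFn h Ω ε x) {C δ : ℝ} (hC : 0 < C)
    (hδ : 0 < δ) (hdecay : ∀ x, |h x| ≤ C * (1 + ‖x‖) ^ (-((n : ℝ) + δ)))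
    {p : ℝ≥0∞} (hp : 1 ≤ p) {f : EuclideanSpace ℝ (Fin n) → ℝ}
    (hf : MemLp f p (volume.restrict Ω)) :
    ∀ᵐ x ∂(volume.restrict Ω),
      Tendsto (fun ε => markovSmooth h Ω ε f x) (𝓝[>] 0) (𝓝 (f x)) := by
  set g := Ω.indicator (hf.1.mk f) with hg
  have hgm : StronglyMeasurable g := hf.1.stronglyMeasurable_mk.indicator hΩ
  have hfg : f =ᵐ[volume.restrict Ω] g :=
    hf.1.ae_eq_mk.trans (indicator_ae_eq_restrict hΩ).symm
  have hgΩ : Ω.indicator g = g := by rw [hg, Set.indicator_indicator, Set.inter_self]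
  have hgp : MemLp g p volume := by
    rw [← hgΩ]
    exact (memLp_indicator_iff_restrict hΩ).2 (hf.ae_eq hfg)
  filter_upwards [hfg, ae_restrict_mem hΩ, ae_restrict_of_ae (ae_tendsto_laverage_enorm_sub
    (hgp.locallyIntegrable hp))] with x hxfg hxΩ hx
  simp only [markovSmooth_congr_ae hfg]
  rw [hxfg, tendsto_iff_edist_tendsto_0]
  obtain ⟨M, hM, hbound⟩ := exists_laverage_le hp hgp x hx
  have hmeas : Measurable fun y => ‖g y - g x‖ₑ := (hgm.measurable.sub_const _).enorm
  have hlim := ENNReal.Tendsto.const_mul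
    (tendsto_shapeAverage_zero hdec hC hδ hdecay hmeas hx hM hbound)
    (.inr (ENNReal.ofReal_ne_top (r := d⁻¹)))
  rw [mul_zero] at hlim
  refine tendsto_of_tendsto_of_tendsto_of_le_of_le' tendsto_const_nhds hlim
    (.of_forall fun _ => zero_le) ?_
  filter_upwards [Ioo_mem_nhdsGT hε₀] with ε hε
  rw [edist_eq_enorm_sub]
  refine (enorm_markovSmooth_sub_le hs hdec hΩ (f := g) (by rw [hgΩ]; exact hgp.1) hε.1 hd
    (hdeg ε hε.1 hε.2 x hxΩ)).trans ?_
  gcongr with z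
  by_cases hz : x + ε • z ∈ Ω <;> simp [hz]

end PointwiseConvergence

/-! ### Continuity by Hölder duality -/

section Continuity

variable {n : ℕ} {h : EuclideanSpace ℝ (Fin n) → ℝ} {Ω : Set (EuclideanSpace ℝ (Fin n))}
  {p q : ℝ≥0∞}

/-- The integral pairs a translate of `k` with `φ`. Translation is continuous in `L^q` because `q ≠
∞`, and isometric, which makes the bound uniform. -/
theorem continuous_bounded_integral_translate_mul [q.HolderConjugate p] (hq : q ≠ ∞)
    {k φ : EuclideanSpace ℝ (Fin n) → ℝ} (hk : MemLp k q) (hφ : MemLp φ p) :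
    (∀ x, Integrable fun y => k (y - x) * φ y) ∧
      Continuous (fun x => ∫ y, k (y - x) * φ y) ∧
      ∃ M : ℝ, ∀ x, |∫ y, k (y - x) * φ y| ≤ M := by
  have hp1 : Fact (1 ≤ p) := ⟨ENNReal.HolderConjugate.one_le p q⟩
  have hq1 : Fact (1 ≤ q) := ⟨ENNReal.HolderConjugate.one_le q p⟩
  have hkx (x : EuclideanSpace ℝ (Fin n)) : MemLp (fun y => k (y - x)) q :=
    hk.comp_measurePreserving (measurePreserving_sub_right volume x)
  set B := (ContinuousLinearMap.mul ℝ ℝ).lpPairing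
    (volume : Measure (EuclideanSpace ℝ (Fin n))) q p with hB
  have hval (x : EuclideanSpace ℝ (Fin n)) : DomAddAct.mk (-x) +ᵥ hk.toLp k =ᵐ[volume]
      fun y => k (y - x) := by
    rw [DomAddAct.mk_vadd_toLp]
    refine (MemLp.coeFn_toLp _).trans (.of_forall fun y => ?_)
    simp [sub_eq_neg_add]
  have hpair (x : EuclideanSpace ℝ (Fin n)) :
      ∫ y, k (y - x) * φ y = B (DomAddAct.mk (-x) +ᵥ hk.toLp k) (hφ.toLp φ) := by
    rw [hB, ContinuousLinearMap.lpPairing_eq_integral]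
    refine integral_congr_ae ?_
    filter_upwards [hval x, hφ.coeFn_toLp] with y h1 h2
    rw [h1, h2, ContinuousLinearMap.mul_apply']
  refine ⟨fun x => (hkx x).integrable_mul hφ, ?_, ‖B‖ * ‖hk.toLp k‖ * ‖hφ.toLp φ‖, fun x => ?_⟩
  · simp only [hpair]
    have hcont : Continuous fun x : EuclideanSpace ℝ (Fin n) =>
        DomAddAct.mk (-x) +ᵥ hk.toLp k :=
      (continuous_mk_vadd_toLp hq (hk.toLp k)).comp continuous_neg
    exact (B.continuous.comp hcont).clm_apply continuous_const
  · rw [hpair, ← Real.norm_eq_abs]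
    refine (B.le_opNorm₂ _ _).trans_eq ?_
    rw [DomAddAct.norm_vadd_Lp]

theorem memLp_comp_inv_smul {k : EuclideanSpace ℝ (Fin n) → ℝ} (hk : MemLp k q) {ε : ℝ}
    (hε : 0 < ε) : MemLp (fun y => k (ε⁻¹ • y)) q := by
  have hqmp := Measure.quasiMeasurePreserving_smul
    (volume : Measure (EuclideanSpace ℝ (Fin n))) (inv_ne_zero hε.ne')
  refine ⟨hk.1.comp_quasiMeasurePreserving hqmp, ?_⟩
  have hmap := Measure.map_addHaar_smul
    (volume : Measure (EuclideanSpace ℝ (Fin n))) (inv_ne_zero hε.ne')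
  have hk' : MemLp k q (Measure.map (ε⁻¹ • ·) volume) := by
    rw [hmap]
    exact hk.smul_measure ENNReal.ofReal_ne_top
  exact ((memLp_map_measure_iff hk'.1 hqmp.measurable.aemeasurable).1 hk').2

theorem continuous_bounded_integral_shape_mul [q.HolderConjugate p] (hq : q ≠ ∞)
    (hk : MemLp h q) {φ : EuclideanSpace ℝ (Fin n) → ℝ} (hφ : MemLp φ p) {ε : ℝ} (hε : 0 < ε) :
    (∀ x, Integrable fun z => h z * φ (x + ε • z)) ∧
      Continuous (fun x => ∫ z, h z * φ (x + ε • z)) ∧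
      ∃ M : ℝ, ∀ x, |∫ z, h z * φ (x + ε • z)| ≤ M := by
  have hscaled : MemLp (scaledShape h ε) q := (memLp_comp_inv_smul hk hε).const_mul _
  simp only [← integral_scaledShape_sub_mul h φ hε, ← integrable_scaledShape_sub_mul_iff h φ hε]
  exact continuous_bounded_integral_translate_mul hq hscaled hφ

theorem continuous_degreeFn (hs : IsShapeFunction h) (hΩ : MeasurableSet Ω) {ε : ℝ}
    (hε : 0 < ε) : Continuous (degreeFn h Ω ε) := by
  rw [show degreeFn h Ω ε = _ from funext fun x => degreeFn_eq hs hε x]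
  have hone : MemLp (Ω.indicator fun _ => (1 : ℝ)) ∞ volume :=
    memLp_top_of_bound (measurable_const.indicator hΩ).aestronglyMeasurable 1
      (.of_forall fun y => by by_cases hy : y ∈ Ω <;> simp [hy])
  -- The dual pair here is `q = 1`, `p = ∞`.
  exact (continuous_bounded_integral_shape_mul ENNReal.one_ne_top
    (memLp_one_iff_integrable.2 hs.integrable) hone hε).2.1

theorem markovSmooth_continuousOn_bounded (hs : IsShapeFunction h) (hΩ : MeasurableSet Ω)
    {ε d : ℝ} (hε : 0 < ε) (hd : 0 < d) (hdeg : ∀ x ∈ Ω, d ≤ degreeFn h Ω ε x)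
    (hp : 1 < p) (hpq : p⁻¹ + q⁻¹ = 1) (hk : MemLp h q)
    {f : EuclideanSpace ℝ (Fin n) → ℝ} (hf : MemLp f p (volume.restrict Ω)) :
    (∀ x ∈ Ω, IntegrableOn (fun y => markovKernel h Ω ε x y * f y) Ω volume) ∧
      ContinuousOn (markovSmooth h Ω ε f) Ω ∧
      ∃ M : ℝ, ∀ x ∈ Ω, |markovSmooth h Ω ε f x| ≤ M := by
  have : q.HolderConjugate p := ⟨by rw [add_comm, hpq, inv_one]⟩
  have hq : q ≠ ∞ := by
    rintro rfl
    rw [ENNReal.inv_top, add_zero, ENNReal.inv_eq_one] at hpq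
    exact hp.ne' hpq
  obtain ⟨hint, hcont, M, hM⟩ := continuous_bounded_integral_shape_mul hq hk
    ((memLp_indicator_iff_restrict hΩ).2 hf) hε
  refine ⟨fun x _ => integrableOn_markovKernel_mul hΩ hε (hint x), ?_, M / d, fun x hx => ?_⟩
  · rw [show markovSmooth h Ω ε f = _ from funext fun x => markovSmooth_eq hΩ f hε x]
    exact hcont.continuousOn.div (continuous_degreeFn hs hΩ hε).continuousOn
      fun x hx => (hd.trans_le (hdeg x hx)).ne'
  · rw [markovSmooth_eq hΩ f hε, abs_div, abs_of_pos (hd.trans_le (hdeg x hx))]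
    have := (abs_nonneg _).trans (hM x)
    gcongr
    · exact hM x
    · exact hdeg x hx

end Continuity

/-! ### Translation and the `L²` Fourier transform -/

section FourierTranslation

variable {n : ℕ}

theorem memLp_top_fourierChar_inner (x : EuclideanSpace ℝ (Fin n)) :
    MemLp (fun ω : EuclideanSpace ℝ (Fin n) => ((𝐞 (inner ℝ x ω) : Circle) : ℂ)) ∞ volume := by
  refine memLp_top_of_bound (Continuous.aestronglyMeasurable ?_) 1
    (.of_forall fun ω => (Circle.norm_coe _).le)
  fun_prop

/-- The identity is classical on Schwartz functions; both sides are continuous in `L²`, so density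
extends it. -/
theorem fourier_vadd_Lp (x : EuclideanSpace ℝ (Fin n))
    (f : Lp ℂ 2 (volume : Measure (EuclideanSpace ℝ (Fin n)))) :
    (𝓕 (DomAddAct.mk x +ᵥ f) : Lp ℂ 2 (volume : Measure (EuclideanSpace ℝ (Fin n)))) =ᵐ[volume]
      fun ω => ((𝐞 (inner ℝ x ω) : Circle) : ℂ) *
        (𝓕 f : Lp ℂ 2 (volume : Measure (EuclideanSpace ℝ (Fin n)))) ω := by
  set m := (memLp_top_fourierChar_inner x).toLp _ with hm
  set T := (ContinuousLinearMap.mul ℂ ℂ).holderL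
    (volume : Measure (EuclideanSpace ℝ (Fin n))) ∞ 2 2 m with hT
  have hTval (g : Lp ℂ 2 (volume : Measure (EuclideanSpace ℝ (Fin n)))) :
      T g =ᵐ[volume] fun ω => ((𝐞 (inner ℝ x ω) : Circle) : ℂ) * g ω := by
    filter_upwards [(ContinuousLinearMap.mul ℂ ℂ).coeFn_holder (r := 2) m g,
      (memLp_top_fourierChar_inner x).coeFn_toLp] with ω h1 h2
    refine h1.trans ?_
    rw [hm, h2, ContinuousLinearMap.mul_apply']
  suffices h : (𝓕 (DomAddAct.mk x +ᵥ f) :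
      Lp ℂ 2 (volume : Measure (EuclideanSpace ℝ (Fin n)))) = T (𝓕 f) by
    rw [h]
    exact hTval _
  refine DenseRange.induction_on (p := fun f => (𝓕 (DomAddAct.mk x +ᵥ f) :
      Lp ℂ 2 (volume : Measure (EuclideanSpace ℝ (Fin n)))) = T (𝓕 f))
    (SchwartzMap.denseRange_toLpCLM (E := EuclideanSpace ℝ (Fin n)) (F := ℂ) (p := 2)
      (μ := volume) ENNReal.ofNat_ne_top) f ?_ ?_
  · refine isClosed_eq ?_ ?_
    · exact (Lp.fourierTransformₗᵢ (EuclideanSpace ℝ (Fin n)) ℂ).continuous.comp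
        (isometry_vadd _ (DomAddAct.mk x)).continuous
    · exact T.continuous.comp (Lp.fourierTransformₗᵢ (EuclideanSpace ℝ (Fin n)) ℂ).continuous
  · intro ψ
    have hshift : (DomAddAct.mk x +ᵥ ψ.toLp 2 volume) =
        (ψ.compSubConstCLM ℂ (-x)).toLp 2 volume := by
      apply Lp.ext
      rw [SchwartzMap.toLp, DomAddAct.mk_vadd_toLp]
      filter_upwards [MemLp.coeFn_toLp ((ψ.memLp 2 volume).comp_measurePreserving
        (measurePreserving_vadd x volume)),
        (ψ.compSubConstCLM ℂ (-x)).coeFn_toLp 2 volume] with v h1 h2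
      rw [h2]
      refine h1.trans ?_
      simp [add_comm]
    rw [SchwartzMap.toLpCLM_apply, hshift, SchwartzMap.toLp_fourier_eq,
      SchwartzMap.toLp_fourier_eq]
    apply Lp.ext
    filter_upwards [SchwartzMap.coeFn_toLp (𝓕 (ψ.compSubConstCLM ℂ (-x))) 2 volume,
      hTval ((𝓕 ψ).toLp 2 volume), SchwartzMap.coeFn_toLp (𝓕 ψ) 2 volume] with ω h1 h2 h3
    rw [h1, h2, h3, SchwartzMap.fourier_coe, SchwartzMap.fourier_coe]
    have := congrFun (VectorFourier.fourierIntegral_comp_add_right 𝐞 volume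
      (innerₗ (EuclideanSpace ℝ (Fin n))) ψ x) ω
    rw [Circle.smul_def, smul_eq_mul] at this
    refine Eq.trans ?_ this
    refine congrArg (fun u : EuclideanSpace ℝ (Fin n) → ℂ =>
      (𝓕 u : EuclideanSpace ℝ (Fin n) → ℂ) ω) ?_
    funext v
    simp

end FourierTranslation

/-! ### Sobolev shape functions and `C^r` regularity -/

section Sobolev

variable {n : ℕ} {h : EuclideanSpace ℝ (Fin n) → ℝ} {Ω : Set (EuclideanSpace ℝ (Fin n))} {r : ℕ}

/-- Since `‖ω‖ ^ (2k) ≤ (1 + ‖ω‖²) ^ r`, the function `‖ω‖ ^ k ‖H‖` is in `L²`; Cauchy–Schwarz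
against `K` finishes. -/
theorem integrable_pow_mul_conj_mul {H K : EuclideanSpace ℝ (Fin n) → ℂ}
    (hH : AEStronglyMeasurable H)
    (hHr : ∫⁻ ω, ‖H ω‖ₑ ^ 2 * ENNReal.ofReal ((1 + ‖ω‖ ^ 2) ^ r) < ∞) (hK : MemLp K 2)
    {k : ℕ} (hk : k ≤ r) :
    Integrable fun ω => ‖ω‖ ^ k * ‖starRingEnd ℂ (H ω) * K ω‖ := by
  have hmem : MemLp (fun ω => ‖ω‖ ^ k * ‖H ω‖) 2 := by
    refine ⟨(continuous_norm.pow k).aestronglyMeasurable.mul hH.norm, ?_⟩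
    refine (eLpNorm_lt_top_iff_lintegral_rpow_enorm_lt_top two_ne_zero ENNReal.ofNat_ne_top).2 ?_
    refine (lintegral_mono fun ω => ?_).trans_lt hHr
    rw [ENNReal.toReal_ofNat, ENNReal.rpow_ofNat, enorm_mul, mul_pow, mul_comm, enorm_norm]
    gcongr
    rw [Real.enorm_of_nonneg (by positivity), ← ENNReal.ofReal_pow (by positivity)]
    apply ENNReal.ofReal_le_ofReal
    have h1 : (1 : ℝ) ≤ 1 + ‖ω‖ ^ 2 := by nlinarith [sq_nonneg ‖ω‖]
    calc (‖ω‖ ^ k) ^ 2 = (‖ω‖ ^ 2) ^ k := by ring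
      _ ≤ (1 + ‖ω‖ ^ 2) ^ k := by gcongr; linarith
      _ ≤ (1 + ‖ω‖ ^ 2) ^ r := pow_le_pow_right₀ h1 hk
  refine (hmem.integrable_mul hK.norm).congr (.of_forall fun ω => ?_)
  simp [mul_assoc]

/-- By Plancherel the integral is the Fourier transform of `conj H * K` at `-x`, and finite moments
up to order `r` give `r` continuous derivatives. -/
theorem contDiff_integral_translate_mul (hr : MemSobolevH r h)
    {φ : EuclideanSpace ℝ (Fin n) → ℝ} (hφ : MemLp φ 2) :
    ContDiff ℝ r fun x => ∫ y, h (y - x) * φ y := by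
  obtain ⟨hL, hfin⟩ := hr
  have hφc : MemLp (fun y => (φ y : ℂ)) 2 volume := hφ.ofReal
  set H := (𝓕 (hL.toLp _) : Lp ℂ 2 (volume : Measure (EuclideanSpace ℝ (Fin n)))) with hH
  set K := (𝓕 (hφc.toLp _) : Lp ℂ 2 (volume : Measure (EuclideanSpace ℝ (Fin n)))) with hK
  have hsmooth : ContDiff ℝ r (𝓕 fun ω => starRingEnd ℂ (H ω) * K ω) := by
    refine Real.contDiff_fourier (N := r) fun k hk => ?_
    exact integrable_pow_mul_conj_mul (Lp.aestronglyMeasurable H) hfin (Lp.memLp K)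
      (by exact_mod_cast hk)
  have hval (x : EuclideanSpace ℝ (Fin n)) : DomAddAct.mk (-x) +ᵥ hL.toLp _ =ᵐ[volume]
      fun y => (h (y - x) : ℂ) := by
    rw [DomAddAct.mk_vadd_toLp]
    refine (MemLp.coeFn_toLp _).trans (.of_forall fun y => ?_)
    simp [sub_eq_neg_add]
  have key (x : EuclideanSpace ℝ (Fin n)) :
      ((∫ y, h (y - x) * φ y : ℝ) : ℂ) = 𝓕 (fun ω => starRingEnd ℂ (H ω) * K ω) (-x) := by
    calc ((∫ y, h (y - x) * φ y : ℝ) : ℂ) = ∫ y, (h (y - x) : ℂ) * φ y := by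
          rw [← integral_complex_ofReal]
          simp
      _ = inner ℂ (DomAddAct.mk (-x) +ᵥ hL.toLp _) (hφc.toLp _) := by
          rw [L2.inner_def]
          refine integral_congr_ae ?_
          filter_upwards [hval x, hφc.coeFn_toLp] with y h1 h2
          rw [h1, h2]
          simp [mul_comm]
      _ = inner ℂ (𝓕 (DomAddAct.mk (-x) +ᵥ hL.toLp _) :
            Lp ℂ 2 (volume : Measure (EuclideanSpace ℝ (Fin n)))) K :=
          (Lp.inner_fourier_eq _ _).symm
      _ = _ := by
          rw [L2.inner_def, Real.fourier_eq]
          refine integral_congr_ae ?_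
          filter_upwards [fourier_vadd_Lp (-x) (hL.toLp _)] with ω h1
          -- Conjugating the translation character produces the Fourier kernel at `-x`.
          rw [h1, Circle.smul_def, smul_eq_mul, RCLike.inner_apply, map_mul,
            ← Circle.coe_inv_eq_conj, ← AddChar.map_neg_eq_inv, real_inner_comm]
          ring
  have hre : (fun x => ∫ y, h (y - x) * φ y) =
      fun x => Complex.reCLM (𝓕 (fun ω => starRingEnd ℂ (H ω) * K ω) (-x)) := by
    funext x
    rw [← key]
    simp
  rw [hre]
  exact Complex.reCLM.contDiff.comp (hsmooth.comp contDiff_neg)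

theorem contDiff_integral_shape_mul (hr : MemSobolevH r h)
    {φ : EuclideanSpace ℝ (Fin n) → ℝ} (hφ : MemLp φ 2) {ε : ℝ} (hε : 0 < ε) :
    ContDiff ℝ r fun x => ∫ z, h z * φ (x + ε • z) := by
  -- The dilation is moved onto `φ`, so the Sobolev condition on `h` is used unscaled.
  have hφε : MemLp (fun y => φ (ε • y)) 2 := by
    simpa using memLp_comp_inv_smul hφ (inv_pos.2 hε)
  have heq : (fun x => ∫ z, h z * φ (x + ε • z)) =
      (fun x => ∫ y, h (y - x) * φ (ε • y)) ∘ fun x => ε⁻¹ • x := by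
    funext x
    rw [Function.comp_apply,
      ← integral_sub_right_eq_self (fun z => h z * φ (x + ε • z)) (ε⁻¹ • x)]
    refine integral_congr_ae (.of_forall fun y => ?_)
    simp [smul_sub, smul_smul, mul_inv_cancel₀ hε.ne']
  rw [heq]
  exact (contDiff_integral_translate_mul hr hφε).comp (contDiff_const_smul _)

theorem MemSobolevH.memLp_two (hr : MemSobolevH r h) : MemLp h 2 := by
  obtain ⟨hL, -⟩ := hr
  simpa using hL.re

theorem markovSmooth_contDiffOn (hs : IsShapeFunction h) (hΩ : MeasurableSet Ω)
    (hbdd : Bornology.IsBounded Ω) (hr : MemSobolevH r h)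
    {ε d : ℝ} (hε : 0 < ε) (hd : 0 < d) (hdeg : ∀ x ∈ Ω, d ≤ degreeFn h Ω ε x)
    {f : EuclideanSpace ℝ (Fin n) → ℝ} (hf : MemLp f 2 (volume.restrict Ω)) :
    (∀ x ∈ Ω, IntegrableOn (fun y => markovKernel h Ω ε x y * f y) Ω volume) ∧
      ContDiffOn ℝ r (markovSmooth h Ω ε f) Ω := by
  have hfΩ : MemLp (Ω.indicator f) 2 volume := (memLp_indicator_iff_restrict hΩ).2 hf
  -- Boundedness of `Ω` puts `1_Ω` in `L²`, so the degree is `C^r` by the same argument as the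
  -- numerator.
  have hone : MemLp (Ω.indicator fun _ => (1 : ℝ)) 2 volume :=
    memLp_indicator_const 2 hΩ 1 (.inr hbdd.measure_lt_top.ne)
  have hint := (continuous_bounded_integral_shape_mul (p := 2) ENNReal.ofNat_ne_top hr.memLp_two
    hfΩ hε).1
  refine ⟨fun x _ => integrableOn_markovKernel_mul hΩ hε (hint x), ?_⟩
  rw [show markovSmooth h Ω ε f = _ from funext fun x => markovSmooth_eq hΩ f hε x]
  refine (contDiff_integral_shape_mul hr hfΩ hε).contDiffOn.div ?_
    fun x hx => (hd.trans_le (hdeg x hx)).ne'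
  rw [show degreeFn h Ω ε = _ from funext fun x => degreeFn_eq hs hε x]
  exact (contDiff_integral_shape_mul hr hone hε).contDiffOn

end Sobolev

/-! ### The main theorem -/

theorem theorem2p5 (n : ℕ) (Ω : Set (EuclideanSpace ℝ (Fin n))) (hΩ : IsOpen Ω)
    (hthick : IsThick Ω) (h : EuclideanSpace ℝ (Fin n) → ℝ) (hshape : IsShapeFunction h)
    (hdec : IsRadiallyDecreasing h) :
    ∃ ε₀ : ℝ, 0 < ε₀ ∧
      -- the normalization is by a positive number
      (∀ ε : ℝ, 0 < ε → ε < ε₀ → ∀ x ∈ Ω, 0 < degreeFn h Ω ε x) ∧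
      -- for each `p ∈ [1, ∞]`, uniform boundedness of `P_ε` on `L^p(Ω)`
      (∀ (p : ℝ≥0∞) [Fact (1 ≤ p)], ∃ A : ℝ, ∀ ε : ℝ, 0 < ε → ε < ε₀ →
        ∃ T : Lp ℝ p (volume.restrict Ω) →L[ℝ] Lp ℝ p (volume.restrict Ω), ‖T‖ ≤ A ∧
          ∀ f : Lp ℝ p (volume.restrict Ω),
            (∀ᵐ x ∂(volume.restrict Ω),
              IntegrableOn (fun y => markovKernel h Ω ε x y * f y) Ω volume) ∧
            T f =ᵐ[volume.restrict Ω] markovSmooth h Ω ε f) ∧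
      (∀ C δ : ℝ, 0 < C → 0 < δ → (∀ x, |h x| ≤ C * (1 + ‖x‖) ^ (-((n : ℝ) + δ))) →
        -- pointwise convergence, `p ∈ (1, ∞]`
        (∀ p : ℝ≥0∞, 1 < p → ∀ f : EuclideanSpace ℝ (Fin n) → ℝ,
          MemLp f p (volume.restrict Ω) →
          ∀ᵐ x ∂(volume.restrict Ω),
            Tendsto (fun ε => markovSmooth h Ω ε f x) (𝓝[>] 0) (𝓝 (f x))) ∧
        -- norm convergence, `p ∈ (1, ∞)`
        (∀ p : ℝ≥0∞, 1 < p → p < ∞ → ∀ f : EuclideanSpace ℝ (Fin n) → ℝ,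
          MemLp f p (volume.restrict Ω) →
          Tendsto (fun ε => eLpNorm (fun x => markovSmooth h Ω ε f x - f x) p (volume.restrict Ω))
            (𝓝[>] 0) (𝓝 0)) ∧
        -- `P_ε f ∈ C_b(Ω)` for `f ∈ L^p(Ω)`, `h ∈ L^q`, `p ∈ (1, ∞]`
        (∀ p q : ℝ≥0∞, 1 < p → p⁻¹ + q⁻¹ = 1 → MemLp h q volume →
          ∀ f : EuclideanSpace ℝ (Fin n) → ℝ, MemLp f p (volume.restrict Ω) →
          ∀ ε : ℝ, 0 < ε → ε < ε₀ →
            (∀ x ∈ Ω, IntegrableOn (fun y => markovKernel h Ω ε x y * f y) Ω volume) ∧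
            ContinuousOn (markovSmooth h Ω ε f) Ω ∧
            ∃ M : ℝ, ∀ x ∈ Ω, |markovSmooth h Ω ε f x| ≤ M) ∧
        -- `P_ε f ∈ C^r(Ω)` for `f ∈ L²(Ω)`, `Ω` bounded, `h ∈ H^r`
        (Bornology.IsBounded Ω → ∀ r : ℕ, MemSobolevH r h →
          ∀ f : EuclideanSpace ℝ (Fin n) → ℝ, MemLp f 2 (volume.restrict Ω) →
          ∀ ε : ℝ, 0 < ε → ε < ε₀ →
            (∀ x ∈ Ω, IntegrableOn (fun y => markovKernel h Ω ε x y * f y) Ω volume) ∧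
            ContDiffOn ℝ r (markovSmooth h Ω ε f) Ω)) := by
  obtain ⟨d, hd, ε₀, hε₀, hdeg⟩ := exists_le_degreeFn hshape hdec hΩ.measurableSet hthick
  refine ⟨ε₀, hε₀, fun ε hε hεlt x hx => hd.trans_le (hdeg ε hε hεlt x hx), ?_, ?_⟩
  -- The reciprocal of the degree bound serves every `p` at once.
  · exact fun p _ => ⟨d⁻¹, fun ε hε hεlt =>
      exists_markovSmooth_Lp hshape hdec hΩ.measurableSet hε hd (hdeg ε hε hεlt) p⟩
  · intro C δ hC hδ hdecay
    refine ⟨fun p hp f hf => ?_, fun p hp1 hp f hf => ?_, fun p q hp hpq hk f hf ε hε hεlt => ?_,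
      fun hbdd r hr f hf ε hε hεlt => ?_⟩
    · exact ae_tendsto_markovSmooth hshape hdec hΩ.measurableSet hd hε₀ hdeg hC hδ hdecay hp.le hf
    · exact tendsto_eLpNorm_markovSmooth_sub hshape hdec hΩ.measurableSet hd hε₀ hdeg hp1.le
        hp.ne hf
    · exact markovSmooth_continuousOn_bounded hshape hΩ.measurableSet hε hd (hdeg ε hε hεlt) hp
        hpq hk hf
    · exact markovSmooth_contDiffOn hshape hΩ.measurableSet hbdd hr hε hd (hdeg ε hε hεlt) hf
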